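/- Let $\Omega\subset\mathbb R^n$ be a bounded domain (a bounded, nonempty, open, connected set). For $f\in L^2(\Omega)$ and a locally bounded function $g:\partial\Omega\to\mathbb R$ (bounded on compact subsets of $\partial\Omega$), a function $u$ on $\Omega$ is called a weak solution of $$-\Delta u=f\ \text{ in }\Omega,\qquad u=g\ \text{ on }\partial\Omega$$ if the following three conditions hold, where $t^+=\max(t,0)$ and $t^-=\max(-t,0)$. (i) $u\in H^1_{loc}(\Omega)$ and $\int_\Omega\nabla u\cdot\nabla\varphi\,dx=\int_\Omega f\varphi\,dx$ for all $\varphi\in C_0^\infty(\Omega)$. (ii) For all $x_0\in\partial\Omega$ and $0<r\le \operatorname{diam}(\Omega)$, the function $v$ on $B_r(x_0)$ that equals $\bigl(u-\sup_{B_r(x_0)\cap\partial\Omega}g\bigr)^+$ in $B_r(x_0)\cap\Omega$ and $0$ in $B_r(x_0)\cap\Omega^c$ belongs to $H^1_{loc}(B_r(x_0))$ and satisfies $$\int_{B_r(x_0)}\nabla v\cdot\nabla\varphi\,dx\le\int_{B_r(x_0)}f^+\varphi\,dx\qquad\text{for all }\varphi\in C_0^\infty(B_r(x_0)),\ \varphi\ge0,$$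 where $f^+$ is extended by $0$ outside $\Omega$. (iii) For all $x_0\in\partial\Omega$ and $0<r\le \operatorname{diam}(\Omega)$, the function $w$ on $B_r(x_0)$ that equals $\bigl(u-\inf_{B_r(x_0)\cap\partial\Omega}g\bigr)^-$ in $B_r(x_0)\cap\Omega$ and $0$ in $B_r(x_0)\cap\Omega^c$ belongs to $H^1_{loc}(B_r(x_0))$ and satisfies $$\int_{B_r(x_0)}\nabla w\cdot\nabla\varphi\,dx\le\int_{B_r(x_0)}f^-\varphi\,dx\qquad\text{for all }\varphi\in C_0^\infty(B_r(x_0)),\ \varphi\ge0,$$ where $f^-$ is extended by $0$ outside $\Omega$. **Lemma.** If $u$ is a weak solution of $-\Delta u=f$ in $\Omega$, $u=g$ on $\partial\Omega$, and $h$ is harmonic in $\mathbb R^n$, then $u-h$ is a weak solution of $$-\Delta (u-h)=f\ \text{ in }\Omega,\qquad u-h=g-h\ \text{ on }\partial\Omega .$$ -/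

import Mathlib

open MeasureTheory Metric Set
open scoped ContDiff Gradient

namespace DirichletWeak

/-- `φ ∈ C₀^∞(U)`: smooth, with compact support contained in `U`. -/
def IsTestFunction {n : ℕ} (U : Set (EuclideanSpace ℝ (Fin n)))
    (φ : EuclideanSpace ℝ (Fin n) → ℝ) : Prop :=
  ContDiff ℝ ∞ φ ∧ HasCompactSupport φ ∧ tsupport φ ⊆ U

/-- `V` is the weak (distributional) gradient of `v` on the open set `U`. -/
def HasWeakGradient {n : ℕ} (U : Set (EuclideanSpace ℝ (Fin n)))
    (v : EuclideanSpace ℝ (Fin n) → ℝ)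
    (V : EuclideanSpace ℝ (Fin n) → EuclideanSpace ℝ (Fin n)) : Prop :=
  LocallyIntegrableOn v U ∧ LocallyIntegrableOn V U ∧
    ∀ φ : EuclideanSpace ℝ (Fin n) → ℝ, IsTestFunction U φ →
      ∀ i : Fin n, ∫ x in U, v x * (∇ φ x) i = - ∫ x in U, φ x * V x i

/-- `v ∈ H¹_loc(U)` with weak gradient `V`: both are square integrable on every compact
subset of `U`. -/
def MemH1Loc {n : ℕ} (U : Set (EuclideanSpace ℝ (Fin n)))
    (v : EuclideanSpace ℝ (Fin n) → ℝ)
    (V : EuclideanSpace ℝ (Fin n) → EuclideanSpace ℝ (Fin n)) : Prop :=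
  HasWeakGradient U v V ∧
    ∀ K : Set (EuclideanSpace ℝ (Fin n)), IsCompact K → K ⊆ U →
      MemLp v 2 (volume.restrict K) ∧ MemLp V 2 (volume.restrict K)

/-- `v ∈ H¹_loc(U)` and `∫_U ∇v · ∇φ ≤ ∫_U F φ` for all nonnegative `φ ∈ C₀^∞(U)`. The weak
gradient is unique up to null sets, so the choice of `V` is immaterial. -/
def IsWeakSubsolution {n : ℕ} (U : Set (EuclideanSpace ℝ (Fin n)))
    (v F : EuclideanSpace ℝ (Fin n) → ℝ) : Prop :=
  ∃ V : EuclideanSpace ℝ (Fin n) → EuclideanSpace ℝ (Fin n), MemH1Loc U v V ∧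
    ∀ φ : EuclideanSpace ℝ (Fin n) → ℝ, IsTestFunction U φ → (∀ x, 0 ≤ φ x) →
      ∫ x in U, inner ℝ (V x) (∇ φ x) ≤ ∫ x in U, F x * φ x

/-- `v ∈ H¹_loc(U)` and `∫_U ∇v · ∇φ = ∫_U F φ` for all `φ ∈ C₀^∞(U)`. -/
def IsLocalSolution {n : ℕ} (U : Set (EuclideanSpace ℝ (Fin n)))
    (v F : EuclideanSpace ℝ (Fin n) → ℝ) : Prop :=
  ∃ V : EuclideanSpace ℝ (Fin n) → EuclideanSpace ℝ (Fin n), MemH1Loc U v V ∧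
    ∀ φ : EuclideanSpace ℝ (Fin n) → ℝ, IsTestFunction U φ →
      ∫ x in U, inner ℝ (V x) (∇ φ x) = ∫ x in U, F x * φ x

/-- `u` is a weak solution of `-Δu = f` in `Ω`, `u = g` on `∂Ω`. Only the values of `u`, `f` on
`Ω` and of `g` on `∂Ω` matter: `Ω.indicator` is extension by zero outside `Ω`. The positive and
negative parts are `max t 0` and `max (-t) 0`. -/
structure IsWeakSolution {n : ℕ} (Ω : Set (EuclideanSpace ℝ (Fin n)))
    (u f g : EuclideanSpace ℝ (Fin n) → ℝ) : Prop where
  memLp_rhs : MemLp f 2 (volume.restrict Ω)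
  locallyBounded_bdry : ∀ K : Set (EuclideanSpace ℝ (Fin n)), IsCompact K → K ⊆ frontier Ω →
    ∃ C : ℝ, ∀ x ∈ K, |g x| ≤ C
  interior : IsLocalSolution Ω u f
  upper : ∀ (r : ℝ) (x₀ : EuclideanSpace ℝ (Fin n)), 0 < r → r ≤ diam Ω → x₀ ∈ frontier Ω →
    IsWeakSubsolution (ball x₀ r)
      (Ω.indicator fun x => max (u x - sSup (g '' (ball x₀ r ∩ frontier Ω))) 0)
      (Ω.indicator fun x => max (f x) 0)
  lower : ∀ (r : ℝ) (x₀ : EuclideanSpace ℝ (Fin n)), 0 < r → r ≤ diam Ω → x₀ ∈ frontier Ω →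
    IsWeakSubsolution (ball x₀ r)
      (Ω.indicator fun x => max (-(u x - sInf (g '' (ball x₀ r ∩ frontier Ω)))) 0)
      (Ω.indicator fun x => max (-f x) 0)

end DirichletWeak

/-! Inside `Ω` the function `u - h` solves the same equation as `u`. The difficulty is at the
boundary: the supremum of `g - h` over a ball is not the supremum of `g` minus `h`. Since `u ↦ -u`
exchanges conditions (ii) and (iii), only (ii) needs an argument. Let `M` be the supremum of `g - h`
on `B_r(x₀) ∩ ∂Ω`, and `w = (u - h - M)⁺` extended by zero.

For every `ε > 0` the truncation `(w - ε)⁺` is a subsolution near each point of the ball. Near a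
point of `Ω` it is the positive part of the local solution `u - h - M - ε` (right-hand side `f`).
Near a boundary point `y`, take a ball so small that `h` oscillates little, and let `k` be the
supremum of `g` on its boundary part. Then `h + M + ε - k ≥ 0` there, so `(w - ε)⁺ = (v - (h + M + ε
- k))⁺` with `v = (u - k)⁺`, and `v` is a subsolution by the hypothesis on `u` in the small ball.
Away from the closure of `Ω` the truncation is zero. The first two cases rest on the fact that the
positive part of a subsolution minus a harmonic function is a subsolution
(`truncationOn_of_subsolution`). A partition of unity glues the local statements.

Letting `ε → 0` requires a gradient bound uniform in `ε`. A Caccioppoli estimate with Fatou's lemma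
(`lintegral_energy_lt_top`) puts `1_{w > 0} ∇(u - h)` in `L²_loc`; it then dominates all truncated
gradients, and `isWeakSubsolution_of_truncations` passes to the limit. Both the positive-part
property and the energy bound come from testing a subsolution with `φ β(v)`
(`integral_comp_le_of_subsolution`), justified by mollification. -/

namespace DirichletWeak

section HarmonicTranslation

open Filter Topology

variable {n : ℕ}

local notation "𝔼" => EuclideanSpace ℝ (Fin n)

/-! ### Mollification and its convergence in L¹ -/

/-- Convolution of `f` with the normalised bump function `ρ`. -/
noncomputable def mollify (ρ : ContDiffBump (0 : 𝔼)) (f : 𝔼 → ℝ) : 𝔼 → ℝ :=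
  convolution (ρ.normed volume) f (ContinuousLinearMap.lsmul ℝ ℝ) volume

lemma mollify_apply (ρ : ContDiffBump (0 : 𝔼)) (f : 𝔼 → ℝ) (x : 𝔼) :
    mollify ρ f x = ∫ y, ρ.normed volume (x - y) * f y := by
  simp [mollify, convolution_eq_swap]

lemma contDiff_mollify (ρ : ContDiffBump (0 : 𝔼)) {f : 𝔼 → ℝ} (hf : LocallyIntegrable f) :
    ContDiff ℝ ∞ (mollify ρ f) :=
  ρ.hasCompactSupport_normed.contDiff_convolution_left _ ρ.contDiff_normed hf

lemma fderiv_mollify (ρ : ContDiffBump (0 : 𝔼)) {f : 𝔼 → ℝ} (hf : LocallyIntegrable f)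
    (x e : 𝔼) :
    fderiv ℝ (mollify ρ f) x e = ∫ y, fderiv ℝ (ρ.normed volume) (x - y) e * f y := by
  have h := (ρ.hasCompactSupport_normed (μ := volume)).hasFDerivAt_convolution_left
    (μ := volume)
    (ContinuousLinearMap.lsmul ℝ ℝ) (ρ.contDiff_normed (μ := volume) (n := 1)) hf x
  have h2 : fderiv ℝ (mollify ρ f) x = _ := h.fderiv
  have h3 := (ρ.hasCompactSupport_normed.fderiv ℝ).convolutionExists_left
    ((ContinuousLinearMap.lsmul ℝ ℝ).precompL 𝔼)
    ((ρ.contDiff_normed (μ := volume) (n := 1)).continuous_fderiv one_ne_zero) hf x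
  rw [h2, convolution_def, ContinuousLinearMap.integral_apply h3]
  rw [← integral_sub_left_eq_self _ volume x]
  simp

lemma integrable_mollify (ρ : ContDiffBump (0 : 𝔼)) {f : 𝔼 → ℝ} (hf : Integrable f) :
    Integrable (mollify ρ f) :=
  ρ.integrable_normed.integrable_convolution _ hf

lemma integral_mollify (ρ : ContDiffBump (0 : 𝔼)) {f : 𝔼 → ℝ} (hf : Integrable f) :
    ∫ x, mollify ρ f x = ∫ x, f x := by
  rw [mollify, integral_convolution _ ρ.integrable_normed hf, ρ.integral_normed]
  simp

lemma abs_mollify_le (ρ : ContDiffBump (0 : 𝔼)) (f : 𝔼 → ℝ) (x : 𝔼) :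
    |mollify ρ f x| ≤ mollify ρ (fun y => |f y|) x := by
  rw [mollify_apply, mollify_apply]
  refine (abs_integral_le_integral_abs).trans_eq (integral_congr_ae (.of_forall fun y => ?_))
  simp [abs_mul, abs_of_nonneg (ρ.nonneg_normed _)]

lemma ae_tendsto_mollify {ρ : ℕ → ContDiffBump (0 : 𝔼)}
    (hρ : Tendsto (fun m => (ρ m).rOut) atTop (𝓝 0)) (hρ' : ∀ m, (ρ m).rOut ≤ 2 * (ρ m).rIn)
    {f : 𝔼 → ℝ} (hf : LocallyIntegrable f) :
    ∀ᵐ x, Tendsto (fun m => mollify (ρ m) f x) atTop (𝓝 (f x)) :=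
  ContDiffBump.ae_convolution_tendsto_right_of_locallyIntegrable hρ (.of_forall hρ') hf

/-- A Scheffé-type argument: convergence holds almost everywhere, and mollification preserves the
integral of `|f|`, so no mass can escape. -/
lemma tendsto_integral_abs_mollify_sub {ρ : ℕ → ContDiffBump (0 : 𝔼)}
    (hρ : Tendsto (fun m => (ρ m).rOut) atTop (𝓝 0)) (hρ' : ∀ m, (ρ m).rOut ≤ 2 * (ρ m).rIn)
    {f : 𝔼 → ℝ} (hf : Integrable f) :
    Tendsto (fun m => ∫ x, |mollify (ρ m) f x - f x|) atTop (𝓝 0) := by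
  have hmf := fun m => integrable_mollify (ρ m) hf
  have hma := fun m => integrable_mollify (ρ m) hf.abs
  have h1 : Tendsto (fun m => ∫ x, min |mollify (ρ m) f x - f x| (2 * |f x|)) atTop
      (𝓝 (∫ _ : 𝔼, (0 : ℝ))) := by
    refine tendsto_integral_of_dominated_convergence (fun x => 2 * |f x|) (fun m => ?_)
      (hf.abs.const_mul 2) (fun m => .of_forall fun x => ?_) ?_
    · exact (((hmf m).sub hf).abs.inf (hf.abs.const_mul 2)).aestronglyMeasurable
    · rw [Real.norm_of_nonneg (by positivity)]
      exact min_le_right _ _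
    · filter_upwards [ae_tendsto_mollify hρ hρ' hf.locallyIntegrable] with x hx
      have : Tendsto (fun m => min |mollify (ρ m) f x - f x| (2 * |f x|)) atTop
          (𝓝 (min |f x - f x| (2 * |f x|))) := (hx.sub_const _).abs.min tendsto_const_nhds
      simpa using this
  have h2 : Tendsto (fun m => ∫ x, max (|f x| - mollify (ρ m) (fun y => |f y|) x) 0) atTop
      (𝓝 (∫ _ : 𝔼, (0 : ℝ))) := by
    refine tendsto_integral_of_dominated_convergence (fun x => |f x|) (fun m => ?_)
      hf.abs (fun m => .of_forall fun x => ?_) ?_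
    · exact (hf.abs.sub (hma m)).pos_part.aestronglyMeasurable
    · rw [Real.norm_of_nonneg (by positivity)]
      have := (abs_nonneg _).trans (abs_mollify_le (ρ m) f x)
      exact max_le (by linarith) (abs_nonneg _)
    · filter_upwards [ae_tendsto_mollify hρ hρ' hf.abs.locallyIntegrable] with x hx
      have : Tendsto (fun m => max (|f x| - mollify (ρ m) (fun y => |f y|) x) 0) atTop
          (𝓝 (max (|f x| - |f x|) 0)) := (hx.const_sub _).max tendsto_const_nhds
      simpa using this
  have h3 := h1.add h2
  simp only [integral_zero, add_zero] at h3
  refine squeeze_zero (fun m => integral_nonneg fun x => abs_nonneg _) (fun m => ?_) h3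
  have hi1 : Integrable (fun x => min |mollify (ρ m) f x - f x| (2 * |f x|)) :=
    ((hmf m).sub hf).abs.inf (hf.abs.const_mul 2)
  have hi2 : Integrable (fun x => max (|f x| - mollify (ρ m) (fun y => |f y|) x) 0) :=
    (hf.abs.sub (hma m)).pos_part
  have h4 : ∫ x, (mollify (ρ m) (fun y => |f y|) x - |f x|) = 0 := by
    rw [integral_sub (hma m) hf.abs, integral_mollify _ hf.abs, sub_self]
  -- Pointwise, if `|f_m - f|` exceeds `2|f|`, the excess is at most `|f|_m - |f|`, because `|f_m| ≤
  -- |f|_m`. The positive part makes the correction nonnegative in the other case, and the last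
  -- summand integrates to zero.
  calc ∫ x, |mollify (ρ m) f x - f x|
      ≤ ∫ x, (min |mollify (ρ m) f x - f x| (2 * |f x|)
          + max (|f x| - mollify (ρ m) (fun y => |f y|) x) 0
          + (mollify (ρ m) (fun y => |f y|) x - |f x|)) := by
        refine integral_mono ((hmf m).sub hf).abs ((hi1.add hi2).add ((hma m).sub hf.abs))
          fun x => ?_
        have h5 := abs_mollify_le (ρ m) f x
        have h6 : |mollify (ρ m) f x - f x| ≤ |mollify (ρ m) f x| + |f x| := abs_sub _ _
        simp only
        rcases min_cases |mollify (ρ m) f x - f x| (2 * |f x|) with h | h <;>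
        rcases max_cases (|f x| - mollify (ρ m) (fun y => |f y|) x) 0 with h' | h' <;> linarith
    _ = _ := by
        refine (integral_add (hi1.add hi2) ((hma m).sub hf.abs)).trans ?_
        exact (congrArg₂ (· + ·) (integral_add hi1 hi2) h4).trans (add_zero _)

/-- Bump functions at the origin whose radii shrink to zero from `δ / 2`. -/
lemma exists_bump_seq {δ : ℝ} (hδ : 0 < δ) : ∃ ρ : ℕ → ContDiffBump (0 : 𝔼),
    Tendsto (fun m => (ρ m).rOut) atTop (𝓝 0) ∧ (∀ m, (ρ m).rOut ≤ 2 * (ρ m).rIn) ∧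
      ∀ m, (ρ m).rOut ≤ δ := by
  refine ⟨fun m => ⟨δ * (1 / ((m : ℝ) + 1)) / 2, δ * (1 / ((m : ℝ) + 1)), by positivity,
    half_lt_self (by positivity)⟩, ?_, fun m => ?_, fun m => ?_⟩
  · simpa using (tendsto_one_div_add_atTop_nhds_zero_nat (𝕜 := ℝ)).const_mul δ
  · simp only; linarith
  · simp only
    refine mul_le_of_le_one_right hδ.le ?_
    rw [div_le_one (by positivity)]
    linarith [(Nat.cast_nonneg m : (0 : ℝ) ≤ m)]

/-! ### Coordinates and integrals of compactly supported products -/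

lemma gradient_coord (φ : 𝔼 → ℝ) (x : 𝔼) (i : Fin n) :
    (∇ φ x) i = fderiv ℝ φ x (EuclideanSpace.single i 1) := by
  rw [← inner_gradient_left, EuclideanSpace.inner_single_right]
  simp

lemma inner_eq_sum (v w : 𝔼) : inner ℝ v w = ∑ i, v i * w i := by
  simp [PiLp.inner_apply, mul_comm]

lemma integral_mul_indicator {U K : Set 𝔼} (hU : MeasurableSet U) (hK : MeasurableSet K)
    (hKU : K ⊆ U) {g : 𝔼 → ℝ} (hg : ∀ x ∉ K, g x = 0) (f : 𝔼 → ℝ) :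
    ∫ x, g x * K.indicator f x = ∫ x in U, g x * f x := by
  rw [setIntegral_eq_of_subset_of_forall_sdiff_eq_zero hU hKU fun x hx => by simp [hg x hx.2],
    ← integral_indicator hK]
  refine integral_congr_ae (.of_forall fun x => ?_)
  by_cases hx : x ∈ K <;> simp [hx]

lemma integrableOn_mul_of_vanish {U K : Set 𝔼} (hU : MeasurableSet U) (hK : IsCompact K)
    {f g : 𝔼 → ℝ} (hf : IntegrableOn f K) (hg : Continuous g) (hg0 : ∀ x ∉ K, g x = 0) :
    IntegrableOn (fun x => f x * g x) U :=
  ((hf.mul_continuousOn hg.continuousOn hK).of_forall_sdiff_eq_zero hU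
    fun x hx => by simp [hg0 x hx.2])

lemma integrableOn_coord {K : Set 𝔼} {V : 𝔼 → 𝔼} (hV : IntegrableOn V K) (i : Fin n) :
    IntegrableOn (fun x => V x i) K :=
  (EuclideanSpace.proj (𝕜 := ℝ) i).integrable_comp hV

lemma LocallyIntegrableOn.coord {U : Set 𝔼} (hU : IsOpen U) {V : 𝔼 → 𝔼}
    (hV : LocallyIntegrableOn V U) (i : Fin n) : LocallyIntegrableOn (fun x => V x i) U :=
  (locallyIntegrableOn_iff hU.isLocallyClosed).2 fun _ hKU hK =>
    integrableOn_coord (hV.mono_set hKU |>.integrableOn_isCompact hK) i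

/-! ### Smooth approximation on a compact set -/

/-- The continuous functions `a m` converge to `f` almost everywhere and in `L¹` on `K`. -/
structure ApproximatesOn (K : Set 𝔼) (a : ℕ → 𝔼 → ℝ) (f : 𝔼 → ℝ) : Prop where
  continuous : ∀ m, Continuous (a m)
  integrableOn : IntegrableOn f K
  ae_tendsto : ∀ᵐ x ∂volume.restrict K, Tendsto (fun m => a m x) atTop (𝓝 (f x))
  tendsto_integral : Tendsto (fun m => ∫ x in K, |a m x - f x|) atTop (𝓝 0)

lemma approximatesOn_mollify {ρ : ℕ → ContDiffBump (0 : 𝔼)}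
    (hρ : Tendsto (fun m => (ρ m).rOut) atTop (𝓝 0)) (hρ' : ∀ m, (ρ m).rOut ≤ 2 * (ρ m).rIn)
    {K K' : Set 𝔼} (hK : MeasurableSet K) (hK' : MeasurableSet K') (hKK' : K ⊆ K')
    {f : 𝔼 → ℝ} (hf : IntegrableOn f K') :
    ApproximatesOn K (fun m => mollify (ρ m) (K'.indicator f)) f := by
  have hi : Integrable (K'.indicator f) := (integrable_indicator_iff hK').2 hf
  refine ⟨fun m => (contDiff_mollify _ hi.locallyIntegrable).continuous, hf.mono_set hKK', ?_, ?_⟩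
  · rw [ae_restrict_iff' hK]
    filter_upwards [ae_tendsto_mollify hρ hρ' hi.locallyIntegrable] with x hx hxK
    simpa [hKK' hxK] using hx
  · refine squeeze_zero (fun m => integral_nonneg fun x => abs_nonneg _) (fun m => ?_)
      (tendsto_integral_abs_mollify_sub hρ hρ' hi)
    have h : ∫ x in K, |mollify (ρ m) (K'.indicator f) x - f x|
        = ∫ x in K, |mollify (ρ m) (K'.indicator f) x - K'.indicator f x| :=
      setIntegral_congr_fun hK fun x hx => by simp [hKK' hx]
    rw [h]
    exact setIntegral_le_integral ((integrable_mollify _ hi).sub hi).abs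
      (.of_forall fun x => abs_nonneg _)

lemma isTestFunction_bump {U : Set 𝔼} (ρ : ContDiffBump (0 : 𝔼)) {x : 𝔼}
    (hx : closedBall x ρ.rOut ⊆ U) :
    IsTestFunction U (fun y => ρ.normed volume (x - y)) := by
  have hs : tsupport (fun y => ρ.normed volume (x - y)) ⊆ closedBall x ρ.rOut := by
    refine closure_minimal (fun y hy => ?_) isClosed_closedBall
    have : x - y ∈ Function.support (ρ.normed volume) := hy
    rw [ρ.support_normed_eq, mem_ball_zero_iff] at this
    rw [mem_closedBall, dist_comm, dist_eq_norm]
    exact this.le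
  exact ⟨ρ.contDiff_normed.comp (contDiff_const.sub contDiff_id),
    (isCompact_closedBall x ρ.rOut).of_isClosed_subset (isClosed_tsupport _) hs, hs.trans hx⟩

lemma gradient_bump_coord (ρ : ContDiffBump (0 : 𝔼)) (x y : 𝔼) (i : Fin n) :
    (∇ (fun y => ρ.normed volume (x - y)) y) i
      = - fderiv ℝ (ρ.normed volume) (x - y) (EuclideanSpace.single i 1) := by
  rw [gradient_coord]
  have h1 : HasFDerivAt (ρ.normed volume) (fderiv ℝ (ρ.normed volume) (x - y)) (x - y) :=
    ((ρ.contDiff_normed (μ := volume) (n := 1)).differentiable one_ne_zero _).hasFDerivAt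
  have h2 := h1.comp y ((hasFDerivAt_id y).const_sub x)
  have h3 : fderiv ℝ (fun y => ρ.normed volume (x - y)) y = _ := h2.fderiv
  rw [h3]
  simp

/-- For `x ∈ K` and a small radius, `y ↦ ρ(x - y)` is an admissible nonnegative test function in
`U`. Inserting it into the weak relations shows that mollification turns them into pointwise ones on
`K`: the mollified gradient is the gradient of the mollified function, and minus its divergence is
at most the mollified `F`. The subsolution property is a premise of one clause only, so the lemma
also serves functions with merely a weak gradient. -/
lemma exists_smooth_approx {U K : Set 𝔼} (hU : IsOpen U) (hK : IsCompact K) (hKU : K ⊆ U)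
    {v F : 𝔼 → ℝ} {V : 𝔼 → 𝔼} (hv : HasWeakGradient U v V) (hF : LocallyIntegrableOn F U) :
    ∃ (a b : ℕ → 𝔼 → ℝ) (A : Fin n → ℕ → 𝔼 → ℝ),
      (∀ m, ContDiff ℝ ∞ (a m)) ∧ (∀ i m, ContDiff ℝ ∞ (A i m)) ∧
      (∀ m, ∀ x ∈ K, ∀ i, fderiv ℝ (a m) x (EuclideanSpace.single i 1) = A i m x) ∧
      ((∀ φ, IsTestFunction U φ → (∀ x, 0 ≤ φ x) →
          ∫ x in U, inner ℝ (V x) (∇ φ x) ≤ ∫ x in U, F x * φ x) →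
        ∀ m, ∀ x ∈ K, - ∑ i, fderiv ℝ (A i m) x (EuclideanSpace.single i 1) ≤ b m x) ∧
      ApproximatesOn K a v ∧ ApproximatesOn K b F ∧
      ∀ i, ApproximatesOn K (A i) (fun x => V x i) := by
  obtain ⟨δ, hδ, hδU⟩ := hK.exists_cthickening_subset_open hU hKU
  obtain ⟨ρ, hρ, hρ', hρδ⟩ := exists_bump_seq (n := n) hδ
  set K' := cthickening δ K
  have hK' : IsCompact K' := hK.cthickening
  have hmK' := hK'.measurableSet
  have hKK' : K ⊆ K' := self_subset_cthickening K
  have hiv : IntegrableOn v K' := (hv.1.mono_set hδU).integrableOn_isCompact hK'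
  have hiF : IntegrableOn F K' := (hF.mono_set hδU).integrableOn_isCompact hK'
  have hiV : ∀ i, IntegrableOn (fun x => V x i) K' :=
    integrableOn_coord ((hv.2.1.mono_set hδU).integrableOn_isCompact hK')
  have hball : ∀ m, ∀ x ∈ K, closedBall x (ρ m).rOut ⊆ K' := fun m x hx y hy =>
    mem_cthickening_of_dist_le _ x _ _ hx ((mem_closedBall.1 hy).trans (hρδ m))
  have hloc : ∀ {f : 𝔼 → ℝ}, IntegrableOn f K' → LocallyIntegrable (K'.indicator f) := fun h =>
    ((integrable_indicator_iff hmK').2 h).locallyIntegrable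
  -- Kernels centred in `K` vanish outside `K'`, so convolving the extension by zero from `K'`
  -- agrees with integrating over `U` against the test function.
  have hz1 : ∀ m, ∀ x ∈ K, ∀ y ∉ K', (ρ m).normed volume (x - y) = 0 := by
    intro m x hx y hy
    by_contra h
    have : x - y ∈ Function.support ((ρ m).normed volume) := h
    rw [(ρ m).support_normed_eq, mem_ball_zero_iff, ← dist_eq_norm, dist_comm] at this
    exact hy (hball m x hx (mem_closedBall.2 this.le))
  have hz2 : ∀ m, ∀ x ∈ K, ∀ e : 𝔼, ∀ y ∉ K', fderiv ℝ ((ρ m).normed volume) (x - y) e = 0 := by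
    intro m x hx e y hy
    by_contra h
    have : x - y ∈ tsupport ((ρ m).normed volume) := by
      refine support_fderiv_subset ℝ (fun h0 => h ?_)
      rw [h0]; rfl
    rw [(ρ m).tsupport_normed_eq, mem_closedBall_zero_iff, ← dist_eq_norm, dist_comm] at this
    exact hy (hball m x hx (mem_closedBall.2 this))
  have hUm := hU.measurableSet
  refine ⟨fun m => mollify (ρ m) (K'.indicator v), fun m => mollify (ρ m) (K'.indicator F),
    fun i m => mollify (ρ m) (K'.indicator fun x => V x i),
    fun m => contDiff_mollify _ (hloc hiv), fun i m => contDiff_mollify _ (hloc (hiV i)),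
    ?_, ?_, approximatesOn_mollify hρ hρ' hK.measurableSet hmK' hKK' hiv,
    approximatesOn_mollify hρ hρ' hK.measurableSet hmK' hKK' hiF,
    fun i => approximatesOn_mollify hρ hρ' hK.measurableSet hmK' hKK' (hiV i)⟩
  · intro m x hx i
    have h := hv.2.2 _ (isTestFunction_bump (ρ m) ((hball m x hx).trans hδU)) i
    beta_reduce
    rw [fderiv_mollify _ (hloc hiv), mollify_apply,
      integral_mul_indicator hUm hmK' hδU (hz2 m x hx _),
      integral_mul_indicator hUm hmK' hδU (hz1 m x hx)]
    simp only [gradient_bump_coord, mul_neg, integral_neg, neg_inj] at h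
    simpa only [mul_comm (v _)] using h
  · intro hsub m x hx
    have h := hsub _ (isTestFunction_bump (ρ m) ((hball m x hx).trans hδU))
      fun y => (ρ m).nonneg_normed _
    beta_reduce
    rw [mollify_apply, integral_mul_indicator hUm hmK' hδU (hz1 m x hx)]
    simp only [inner_eq_sum, gradient_bump_coord] at h
    rw [integral_finsetSum] at h
    · simp only [mul_neg, integral_neg, Finset.sum_neg_distrib] at h
      have h2 : ∀ i, fderiv ℝ (mollify (ρ m) (K'.indicator fun x => V x i)) x
          (EuclideanSpace.single i 1) = ∫ y in U, V y i *
            fderiv ℝ ((ρ m).normed volume) (x - y) (EuclideanSpace.single i 1) := fun i => by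
        rw [fderiv_mollify _ (hloc (hiV i)), integral_mul_indicator hUm hmK' hδU (hz2 m x hx _)]
        simp only [mul_comm]
      simp only [h2]
      simpa only [mul_comm (F _)] using h
    · intro i _
      refine integrableOn_mul_of_vanish hUm hK' (hiV i) ?_ fun y hy => by
        rw [hz2 m x hx _ y hy, neg_zero]
      have hc := ((ρ m).contDiff_normed (μ := volume) (n := 1)).continuous_fderiv one_ne_zero
      exact ((hc.comp (continuous_const.sub continuous_id)).clm_apply continuous_const).neg

/-- Split `c_m b_m = c_m (b_m - f) + c_m f`: the first part is controlled by the L¹ convergence of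
`b_m`, the second by dominated convergence. -/
lemma ApproximatesOn.tendsto_integral_mul {K : Set 𝔼} (hK : IsCompact K) {b : ℕ → 𝔼 → ℝ}
    {f : 𝔼 → ℝ} (hb : ApproximatesOn K b f) {c : ℕ → 𝔼 → ℝ} {c' : 𝔼 → ℝ} {C : ℝ}
    (hc : ∀ m, Continuous (c m)) (hC : ∀ m, ∀ x ∈ K, |c m x| ≤ C)
    (hlim : ∀ᵐ x ∂volume.restrict K, Tendsto (fun m => c m x) atTop (𝓝 (c' x))) :
    Tendsto (fun m => ∫ x in K, c m x * b m x) atTop (𝓝 (∫ x in K, c' x * f x)) := by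
  have hbi : ∀ m, IntegrableOn (b m) K := fun m =>
    (hb.continuous m).continuousOn.integrableOn_compact hK
  have hCe : ∀ m, ∀ᵐ x ∂volume.restrict K, |c m x| ≤ C := fun m =>
    (ae_restrict_iff' hK.measurableSet).2 (.of_forall fun x hx => hC m x hx)
  have hbf : ∀ m, IntegrableOn (fun x => c m x * (b m x - f x)) K := fun m =>
    ((hbi m).sub hb.integrableOn).continuousOn_mul (hc m).continuousOn hK
  have hcf : ∀ m, IntegrableOn (fun x => c m x * f x) K := fun m =>
    hb.integrableOn.continuousOn_mul (hc m).continuousOn hK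
  have h1 : Tendsto (fun m => ∫ x in K, c m x * (b m x - f x)) atTop (𝓝 0) := by
    rw [tendsto_zero_iff_abs_tendsto_zero]
    have h2 := hb.tendsto_integral.const_mul C
    rw [mul_zero] at h2
    refine squeeze_zero (fun m => abs_nonneg _) (fun m => ?_) h2
    rw [← integral_const_mul]
    refine abs_integral_le_integral_abs.trans (integral_mono_ae (hbf m).abs
      ((((hbi m).sub hb.integrableOn).abs).const_mul C) ?_)
    filter_upwards [hCe m] with x hx
    rw [abs_mul]
    exact mul_le_mul_of_nonneg_right hx (abs_nonneg _)
  have h3 : Tendsto (fun m => ∫ x in K, c m x * f x) atTop (𝓝 (∫ x in K, c' x * f x)) := by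
    refine tendsto_integral_of_dominated_convergence (fun x => C * |f x|)
      (fun m => (hcf m).aestronglyMeasurable) (hb.integrableOn.abs.const_mul C) (fun m => ?_) ?_
    · filter_upwards [hCe m] with x hx
      rw [Real.norm_eq_abs, abs_mul]
      exact mul_le_mul_of_nonneg_right hx (abs_nonneg _)
    · filter_upwards [hlim] with x hx using hx.mul_const _
  have h4 := h1.add h3
  rw [zero_add] at h4
  refine h4.congr fun m => ?_
  rw [← integral_add (hbf m) (hcf m)]
  exact integral_congr_ae (.of_forall fun x => by simp only; ring)

/-! ### Chain rule and testing with `φ β(v)` -/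

lemma abs_sub_le_of_deriv_bound {B β : ℝ → ℝ} (hB : ∀ t, HasDerivAt B (β t) t) {C : ℝ}
    (hC : ∀ t, |β t| ≤ C) (s t : ℝ) : |B s - B t| ≤ C * |s - t| :=
  convex_univ.norm_image_sub_le_of_norm_hasDerivWithin_le
    (fun x _ => (hB x).hasDerivWithinAt) (fun x _ => hC x) (mem_univ t) (mem_univ s)

lemma integrableOn_comp_of_deriv_bound {K : Set 𝔼} (hK : IsCompact K) {v : 𝔼 → ℝ}
    (hv : IntegrableOn v K) {B β : ℝ → ℝ} (hB : ∀ t, HasDerivAt B (β t) t) {C : ℝ}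
    (hC : ∀ t, |β t| ≤ C) : IntegrableOn (fun x => B (v x)) K := by
  have hBc : Continuous B := continuous_iff_continuousAt.2 fun t => (hB t).continuousAt
  have : IsFiniteMeasure (volume.restrict K) := ⟨by simpa using hK.measure_lt_top⟩
  refine Integrable.mono' ((integrable_const |B 0|).add (hv.abs.const_mul C))
    (hBc.comp_aestronglyMeasurable hv.aestronglyMeasurable) (.of_forall fun x => ?_)
  have h1 := abs_sub_le_of_deriv_bound hB hC (v x) 0
  have h2 := abs_sub_abs_le_abs_sub (B (v x)) (B 0)
  simp only [sub_zero] at h1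
  simp only [Real.norm_eq_abs, Pi.add_apply]
  linarith

lemma ApproximatesOn.comp {K : Set 𝔼} (hK : IsCompact K) {a : ℕ → 𝔼 → ℝ} {v : 𝔼 → ℝ}
    (ha : ApproximatesOn K a v) {B β : ℝ → ℝ} (hB : ∀ t, HasDerivAt B (β t) t) {C : ℝ}
    (hC : ∀ t, |β t| ≤ C) :
    ApproximatesOn K (fun m x => B (a m x)) (fun x => B (v x)) := by
  have hBc : Continuous B := continuous_iff_continuousAt.2 fun t => (hB t).continuousAt
  have hi := integrableOn_comp_of_deriv_bound hK ha.integrableOn hB hC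
  have hai : ∀ m, IntegrableOn (a m) K := fun m =>
    (ha.continuous m).continuousOn.integrableOn_compact hK
  refine ⟨fun m => hBc.comp (ha.continuous m), hi, ?_, ?_⟩
  · filter_upwards [ha.ae_tendsto] with x hx using (hBc.tendsto _).comp hx
  · have h2 := ha.tendsto_integral.const_mul C
    rw [mul_zero] at h2
    refine squeeze_zero (fun m => integral_nonneg fun x => abs_nonneg _) (fun m => ?_) h2
    rw [← integral_const_mul]
    refine integral_mono ?_ (((hai m).sub ha.integrableOn).abs.const_mul C) fun x =>
      abs_sub_le_of_deriv_bound hB hC _ _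
    exact ((integrableOn_comp_of_deriv_bound hK (hai m) hB hC).sub hi).abs

lemma IsTestFunction.differentiable {U : Set 𝔼} {φ : 𝔼 → ℝ} (hφ : IsTestFunction U φ) :
    Differentiable ℝ φ := hφ.1.differentiable (by simp)

lemma IsTestFunction.continuous_fderiv_apply {U : Set 𝔼} {φ : 𝔼 → ℝ} (hφ : IsTestFunction U φ)
    (e : 𝔼) : Continuous fun x => fderiv ℝ φ x e :=
  (hφ.1.continuous_fderiv (by simp)).clm_apply continuous_const

lemma eq_zero_of_notMem_tsupport {φ : 𝔼 → ℝ} {x : 𝔼} (hx : x ∉ tsupport φ) : φ x = 0 :=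
  image_eq_zero_of_notMem_tsupport hx

lemma fderiv_eq_zero_of_notMem_tsupport {φ : 𝔼 → ℝ} {x : 𝔼} (hx : x ∉ tsupport φ) :
    fderiv ℝ φ x = 0 := by
  by_contra h
  exact hx (support_fderiv_subset ℝ h)

lemma gradient_eq_zero_of_notMem_tsupport {φ : 𝔼 → ℝ} {x : 𝔼} (hx : x ∉ tsupport φ) :
    ∇ φ x = 0 := by
  rw [gradient, fderiv_eq_zero_of_notMem_tsupport hx, map_zero]

lemma IsTestFunction.continuous_gradient {U : Set 𝔼} {φ : 𝔼 → ℝ} (hφ : IsTestFunction U φ) :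
    Continuous (∇ φ) :=
  (InnerProductSpace.toDual ℝ 𝔼).symm.continuous.comp (hφ.1.continuous_fderiv (by simp))

lemma setIntegral_eq_tsupport {U : Set 𝔼} (hU : MeasurableSet U) {φ : 𝔼 → ℝ}
    (hφ : tsupport φ ⊆ U) {g : 𝔼 → ℝ} (hg : ∀ x ∉ tsupport φ, g x = 0) :
    ∫ x in U, g x = ∫ x in tsupport φ, g x :=
  setIntegral_eq_of_subset_of_forall_sdiff_eq_zero hU hφ fun x hx => hg x hx.2

lemma integral_eq_tsupport {φ g : 𝔼 → ℝ} (hg : ∀ x ∉ tsupport φ, g x = 0) :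
    ∫ x, g x = ∫ x in tsupport φ, g x :=
  (setIntegral_eq_integral_of_forall_compl_eq_zero hg).symm

lemma integrable_of_vanish {K : Set 𝔼} (hK : IsCompact K) {g : 𝔼 → ℝ} (hg : Continuous g)
    (h0 : ∀ x ∉ K, g x = 0) : Integrable g :=
  hg.integrable_of_hasCompactSupport (HasCompactSupport.intro hK h0)

lemma exists_abs_le_of_continuous {K : Set 𝔼} (hK : IsCompact K) {g : 𝔼 → ℝ} (hg : Continuous g) :
    ∃ C, 0 ≤ C ∧ ∀ x ∈ K, |g x| ≤ C := by
  obtain ⟨C, hC⟩ := hK.exists_bound_of_continuousOn hg.continuousOn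
  exact ⟨max C 0, le_max_right _ _, fun x hx => (hC x hx).trans (le_max_left _ _)⟩

lemma LocallyIntegrableOn.bdd_comp_smul {U : Set 𝔼} (hU : IsOpen U) {v : 𝔼 → ℝ} {V : 𝔼 → 𝔼}
    (hv : LocallyIntegrableOn v U) (hV : LocallyIntegrableOn V U) {β : ℝ → ℝ}
    (hβ : Measurable β) {C : ℝ} (hC : ∀ t, |β t| ≤ C) :
    LocallyIntegrableOn (fun x => β (v x) • V x) U := by
  rw [locallyIntegrableOn_iff hU.isLocallyClosed] at hv hV ⊢
  intro K hKU hK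
  exact (hV K hKU hK).bdd_smul C
    (hβ.comp_aemeasurable (hv K hKU hK).aestronglyMeasurable.aemeasurable).aestronglyMeasurable
    (.of_forall fun x => hC _)

/-- The identity holds for the smooth approximants by integration by parts. In the limit the factor
`β(a_m)` is bounded and converges almost everywhere, while `A_i` converges in L¹. -/
lemma HasWeakGradient.comp {U : Set 𝔼} (hU : IsOpen U) {v : 𝔼 → ℝ} {V : 𝔼 → 𝔼}
    (hv : HasWeakGradient U v V) {B β : ℝ → ℝ} (hB : ∀ t, HasDerivAt B (β t) t)
    (hβ : Continuous β) {C : ℝ} (hC : ∀ t, |β t| ≤ C) :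
    HasWeakGradient U (fun x => B (v x)) (fun x => β (v x) • V x) := by
  refine ⟨?_, LocallyIntegrableOn.bdd_comp_smul hU hv.1 hv.2.1 hβ.measurable hC, ?_⟩
  · rw [locallyIntegrableOn_iff hU.isLocallyClosed]
    exact fun K hKU hK => integrableOn_comp_of_deriv_bound hK
      ((hv.1.mono_set hKU).integrableOn_isCompact hK) hB hC
  intro φ hφ i
  have hK : IsCompact (tsupport φ) := hφ.2.1
  obtain ⟨a, -, A, ha, -, hgrad, -, hav, -, hAV⟩ :=
    exists_smooth_approx hU hK hφ.2.2 hv (F := 0) locallyIntegrableOn_zero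
  set e : 𝔼 := EuclideanSpace.single i 1
  have hBc : Continuous B := continuous_iff_continuousAt.2 fun t => (hB t).continuousAt
  obtain ⟨C1, hC10, hC1⟩ := exists_abs_le_of_continuous hK (hφ.continuous_fderiv_apply e)
  obtain ⟨C2, hC20, hC2⟩ := exists_abs_le_of_continuous hK hφ.1.continuous
  have hl1 := (hav.comp hK hB hC).tendsto_integral_mul hK (c := fun _ x => fderiv ℝ φ x e)
    (c' := fun x => fderiv ℝ φ x e) (fun _ => hφ.continuous_fderiv_apply e) (fun _ => hC1)
    (.of_forall fun x => tendsto_const_nhds)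
  have hl2 := (hAV i).tendsto_integral_mul hK (c := fun m x => φ x * β (a m x))
    (c' := fun x => φ x * β (v x)) (C := C2 * C)
    (fun m => hφ.1.continuous.mul (hβ.comp (hav.continuous m)))
    (fun m x hx => by
      rw [abs_mul]
      exact mul_le_mul (hC2 x hx) (hC _) (abs_nonneg _) hC20)
    (by filter_upwards [hav.ae_tendsto] with x hx
        exact ((hβ.tendsto _).comp hx).const_mul _)
  have hfd : ∀ m x, HasFDerivAt (fun x => B (a m x)) (β (a m x) • fderiv ℝ (a m) x) x :=
    fun m x => (hB (a m x)).comp_hasFDerivAt x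
      ((ha m).differentiable (by simp) x).hasFDerivAt
  have hac : ∀ m, Continuous fun x => fderiv ℝ (a m) x e := fun m =>
    ((ha m).continuous_fderiv (by simp)).clm_apply continuous_const
  have key : ∀ m, ∫ x in tsupport φ, fderiv ℝ φ x e * B (a m x)
      = - ∫ x in tsupport φ, φ x * β (a m x) * A i m x := by
    intro m
    have hip := integral_mul_fderiv_eq_neg_fderiv_mul_of_integrable (μ := volume)
      (f := fun x => B (a m x)) (g := φ) (v := e) ?_ ?_ ?_
      (fun x _ => (hfd m x).differentiableAt) (fun x _ => hφ.differentiable x)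
    · rw [integral_eq_tsupport (φ := φ)
        (fun x hx => by simp [fderiv_eq_zero_of_notMem_tsupport hx]),
        integral_eq_tsupport (φ := φ)
        (fun x hx => by simp [eq_zero_of_notMem_tsupport hx])] at hip
      calc _ = ∫ x in tsupport φ, B (a m x) * fderiv ℝ φ x e := by simp only [mul_comm]
        _ = _ := by
          rw [hip]
          congr 1
          refine setIntegral_congr_fun hK.measurableSet fun x hx => ?_
          simp only [(hfd m x).fderiv, _root_.smul_apply, smul_eq_mul, ← hgrad m x hx i]
          ring
    · simp only [fun x => (hfd m x).fderiv, _root_.smul_apply, smul_eq_mul]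
      exact integrable_of_vanish hK (((hβ.comp (hav.continuous m)).mul (hac m)).mul
        hφ.1.continuous) fun x hx => by simp [eq_zero_of_notMem_tsupport hx]
    · exact integrable_of_vanish hK ((hBc.comp (hav.continuous m)).mul
        (hφ.continuous_fderiv_apply e)) fun x hx => by simp [fderiv_eq_zero_of_notMem_tsupport hx]
    · exact integrable_of_vanish hK ((hBc.comp (hav.continuous m)).mul
        hφ.1.continuous) fun x hx => by simp [eq_zero_of_notMem_tsupport hx]
  have hfin := tendsto_nhds_unique (hl1.congr key) hl2.neg
  simp only [gradient_coord]
  rw [setIntegral_eq_tsupport hU.measurableSet hφ.2.2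
      (fun x hx => by simp [fderiv_eq_zero_of_notMem_tsupport hx]),
    setIntegral_eq_tsupport hU.measurableSet hφ.2.2
      (fun x hx => by simp [eq_zero_of_notMem_tsupport hx])]
  simp only [mul_comm (B _), PiLp.smul_apply, smul_eq_mul, ← mul_assoc]
  exact hfin

/-- Testing a subsolution with `φ β(v)`; the truncation at level `k` makes the quadratic term
integrable without assuming `v ∈ H¹_loc`. -/
lemma integral_comp_le_of_subsolution {U : Set 𝔼} (hU : IsOpen U) {v F : 𝔼 → ℝ} {V : 𝔼 → 𝔼}
    (hv : HasWeakGradient U v V) (hF : LocallyIntegrableOn F U)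
    (hsub : ∀ φ, IsTestFunction U φ → (∀ x, 0 ≤ φ x) →
      ∫ x in U, inner ℝ (V x) (∇ φ x) ≤ ∫ x in U, F x * φ x)
    {β β' : ℝ → ℝ} (hβ : ∀ t, HasDerivAt β (β' t) t) (hβ' : Continuous β')
    (hβ'0 : ∀ t, 0 ≤ β' t) {C : ℝ} (hC : ∀ t, |β t| ≤ C) (hβ0 : ∀ t, 0 ≤ β t)
    {φ : 𝔼 → ℝ} (hφ : IsTestFunction U φ) (hφ0 : ∀ x, 0 ≤ φ x) {k : ℝ} (hk : 0 ≤ k) :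
    (∫ x in U, β (v x) * inner ℝ (V x) (∇ φ x)) + ∫ x in U, min (φ x * β' (v x) * ‖V x‖ ^ 2) k
      ≤ ∫ x in U, φ x * β (v x) * F x := by
  have hK : IsCompact (tsupport φ) := hφ.2.1
  have hUm := hU.measurableSet
  have hKfin : IsFiniteMeasure (volume.restrict (tsupport φ)) :=
    ⟨by simpa using hK.measure_lt_top⟩
  obtain ⟨a, b, A, ha, hA, hgrad, hdiv, hav, hbF, hAV⟩ :=
    exists_smooth_approx hU hK hφ.2.2 hv hF
  replace hdiv := hdiv hsub
  have hβc : Continuous β := continuous_iff_continuousAt.2 fun t => (hβ t).continuousAt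
  let e : Fin n → 𝔼 := fun i => EuclideanSpace.single i 1
  have hac : ∀ m i, Continuous fun x => fderiv ℝ (a m) x (e i) := fun m i =>
    ((ha m).continuous_fderiv (by simp)).clm_apply continuous_const
  have hAc : ∀ m i, Continuous fun x => fderiv ℝ (A i m) x (e i) := fun m i =>
    ((hA i m).continuous_fderiv (by simp)).clm_apply continuous_const
  have hβa : ∀ m, Continuous fun x => β (a m x) := fun m => hβc.comp (hav.continuous m)
  have hβ'a : ∀ m, Continuous fun x => β' (a m x) := fun m => hβ'.comp (hav.continuous m)
  have hfd : ∀ m x, HasFDerivAt (fun x => φ x * β (a m x))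
      (φ x • (β' (a m x) • fderiv ℝ (a m) x) + β (a m x) • fderiv ℝ φ x) x := fun m x =>
    (hφ.differentiable x).hasFDerivAt.mul
      ((hβ (a m x)).comp_hasFDerivAt x ((ha m).differentiable (by simp) x).hasFDerivAt)
  have hio : ∀ {g : 𝔼 → ℝ}, Continuous g → IntegrableOn g (tsupport φ) := fun hg =>
    hg.continuousOn.integrableOn_compact hK
  -- Integration by parts of `φ β(a_m)` against `A_i`. On the support of `φ` one has `∂_i a_m =
  -- A_i`, which makes the `β'` term a square.
  have hip : ∀ m i, ∫ x in tsupport φ, φ x * β (a m x) * fderiv ℝ (A i m) x (e i)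
      = - ∫ x in tsupport φ, (fderiv ℝ φ x (e i) * β (a m x) * A i m x
          + φ x * β' (a m x) * A i m x ^ 2) := by
    intro m i
    have h := integral_mul_fderiv_eq_neg_fderiv_mul_of_integrable (μ := volume)
      (f := fun x => φ x * β (a m x)) (g := A i m) (v := e i) ?_ ?_ ?_
      (fun x _ => (hfd m x).differentiableAt) (fun x _ => (hA i m).differentiable (by simp) x)
    · rw [integral_eq_tsupport (φ := φ)
        (fun x hx => by simp [eq_zero_of_notMem_tsupport hx]),
        integral_eq_tsupport (φ := φ)
        (fun x hx => by simp [(hfd m x).fderiv, eq_zero_of_notMem_tsupport hx,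
          fderiv_eq_zero_of_notMem_tsupport hx])] at h
      rw [h]
      congr 1
      refine setIntegral_congr_fun hK.measurableSet fun x hx => ?_
      simp only [(hfd m x).fderiv, _root_.smul_apply, _root_.add_apply,
        smul_eq_mul, e, hgrad m x hx i]
      ring
    · simp only [fun x => (hfd m x).fderiv, _root_.smul_apply,
        _root_.add_apply, smul_eq_mul]
      exact integrable_of_vanish hK (((hφ.1.continuous.mul ((hβ'a m).mul (hac m i))).add
        ((hβa m).mul (hφ.continuous_fderiv_apply _))).mul (hA i m).continuous) fun x hx => by
          simp [eq_zero_of_notMem_tsupport hx, fderiv_eq_zero_of_notMem_tsupport hx]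
    · exact integrable_of_vanish hK ((hφ.1.continuous.mul (hβa m)).mul (hAc m i))
        fun x hx => by simp [eq_zero_of_notMem_tsupport hx]
    · exact integrable_of_vanish hK ((hφ.1.continuous.mul (hβa m)).mul (hA i m).continuous)
        fun x hx => by simp [eq_zero_of_notMem_tsupport hx]
  have hci : ∀ m i, Continuous fun x => fderiv ℝ φ x (e i) * β (a m x) * A i m x := fun m i =>
    ((hφ.continuous_fderiv_apply _).mul (hβa m)).mul (hA i m).continuous
  have hcq : ∀ m, Continuous fun x => φ x * β' (a m x) * ∑ i, A i m x ^ 2 := fun m =>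
    (hφ.1.continuous.mul (hβ'a m)).mul (continuous_finsetSum _ fun i _ => (hA i m).continuous.pow 2)
  have hcqi : ∀ m i, Continuous fun x => φ x * β' (a m x) * A i m x ^ 2 := fun m i =>
    (hφ.1.continuous.mul (hβ'a m)).mul ((hA i m).continuous.pow 2)
  have hcd : ∀ m i, Continuous fun x => φ x * β (a m x) * fderiv ℝ (A i m) x (e i) := fun m i =>
    (hφ.1.continuous.mul (hβa m)).mul (hAc m i)
  have key : ∀ m, (∑ i, ∫ x in tsupport φ, fderiv ℝ φ x (e i) * β (a m x) * A i m x)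
      + ∫ x in tsupport φ, min (φ x * β' (a m x) * ∑ i, A i m x ^ 2) k
      ≤ ∫ x in tsupport φ, φ x * β (a m x) * b m x := by
    intro m
    calc _ ≤ (∑ i, ∫ x in tsupport φ, fderiv ℝ φ x (e i) * β (a m x) * A i m x)
          + ∫ x in tsupport φ, φ x * β' (a m x) * ∑ i, A i m x ^ 2 := by
          refine add_le_add le_rfl (integral_mono (hio ((hcq m).min continuous_const))
            (hio (hcq m)) fun x => ?_)
          exact min_le_left _ _
      _ = - ∑ i, ∫ x in tsupport φ, φ x * β (a m x) * fderiv ℝ (A i m) x (e i) := by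
          simp only [Finset.mul_sum]
          rw [integral_finsetSum _ fun i _ => hio (hcqi m i), ← Finset.sum_add_distrib, ← Finset.sum_neg_distrib]
          refine Finset.sum_congr rfl fun i _ => ?_
          rw [hip, neg_neg, integral_add (hio (hci m i)) (hio (hcqi m i))]
      _ = ∫ x in tsupport φ, φ x * β (a m x) * (- ∑ i, fderiv ℝ (A i m) x (e i)) := by
          rw [← integral_finsetSum _ fun i _ => hio (hcd m i),
            ← integral_neg]
          refine integral_congr_ae (.of_forall fun x => ?_)
          simp only [Finset.mul_sum, mul_neg]
      _ ≤ _ := by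
          refine setIntegral_mono_on (hio ((hφ.1.continuous.mul (hβa m)).mul
            (continuous_finsetSum _ fun i _ => hAc m i).neg))
            (hio ((hφ.1.continuous.mul (hβa m)).mul (hbF.continuous m))) hK.measurableSet
            fun x hx => mul_le_mul_of_nonneg_left (hdiv m x hx) (mul_nonneg (hφ0 x) (hβ0 _))
  obtain ⟨C2, hC20, hC2⟩ := exists_abs_le_of_continuous hK hφ.1.continuous
  have hl3 := hbF.tendsto_integral_mul hK (c := fun m x => φ x * β (a m x))
    (c' := fun x => φ x * β (v x)) (C := C2 * C) (fun m => hφ.1.continuous.mul (hβa m))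
    (fun m x hx => by
      rw [abs_mul]
      exact mul_le_mul (hC2 x hx) (hC _) (abs_nonneg _) hC20)
    (by filter_upwards [hav.ae_tendsto] with x hx
        exact ((hβc.tendsto _).comp hx).const_mul _)
  have hl1 : ∀ i, Tendsto (fun m => ∫ x in tsupport φ, fderiv ℝ φ x (e i) * β (a m x) * A i m x)
      atTop (𝓝 (∫ x in tsupport φ, fderiv ℝ φ x (e i) * β (v x) * V x i)) := by
    intro i
    obtain ⟨C1, hC10, hC1⟩ := exists_abs_le_of_continuous hK (hφ.continuous_fderiv_apply (e i))
    refine (hAV i).tendsto_integral_mul hK (C := C1 * C)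
      (fun m => (hφ.continuous_fderiv_apply _).mul (hβa m))
      (fun m x hx => ?_) ?_
    · rw [abs_mul]
      exact mul_le_mul (hC1 x hx) (hC _) (abs_nonneg _) hC10
    · filter_upwards [hav.ae_tendsto] with x hx
      exact ((hβc.tendsto _).comp hx).const_mul _
  -- The squares need not converge in L¹; the cap `k` provides a constant majorant on a set of
  -- finite measure.
  have hl2 : Tendsto (fun m => ∫ x in tsupport φ, min (φ x * β' (a m x) * ∑ i, A i m x ^ 2) k)
      atTop (𝓝 (∫ x in tsupport φ, min (φ x * β' (v x) * ∑ i, V x i ^ 2) k)) := by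
    refine tendsto_integral_of_dominated_convergence (fun _ => k)
      (fun m => ((hcq m).min continuous_const).aestronglyMeasurable) (integrable_const _)
      (fun m => .of_forall fun x => ?_) ?_
    · rw [Real.norm_of_nonneg]
      · exact min_le_right _ _
      · exact le_min (mul_nonneg (mul_nonneg (hφ0 x) (hβ'0 _))
          (Finset.sum_nonneg fun i _ => sq_nonneg _)) hk
    · filter_upwards [hav.ae_tendsto, ae_all_iff.2 fun i => (hAV i).ae_tendsto] with x hx hx'
      exact ((((hβ'.tendsto _).comp hx).const_mul _).mul
        (tendsto_finsetSum _ fun i _ => (hx' i).pow 2)).min tendsto_const_nhds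
  have hfin := le_of_tendsto_of_tendsto' ((tendsto_finsetSum _ fun i _ => hl1 i).add hl2) hl3 key
  have hiV : ∀ i, IntegrableOn (fun x => V x i) (tsupport φ) := fun i => (hAV i).integrableOn
  rw [setIntegral_eq_tsupport hUm hφ.2.2
      (fun x hx => by simp [gradient_eq_zero_of_notMem_tsupport hx]),
    setIntegral_eq_tsupport hUm hφ.2.2 (g := fun x => min (φ x * β' (v x) * ‖V x‖ ^ 2) k)
      (fun x hx => by simp [eq_zero_of_notMem_tsupport hx, hk]),
    setIntegral_eq_tsupport hUm hφ.2.2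
      (fun x hx => by simp [eq_zero_of_notMem_tsupport hx])]
  refine le_trans (le_of_eq ?_) hfin
  congr 1
  · rw [← integral_finsetSum]
    · refine integral_congr_ae (.of_forall fun x => ?_)
      simp only [inner_eq_sum, gradient_coord, Finset.mul_sum, e]
      exact Finset.sum_congr rfl fun i _ => by ring
    · intro i _
      obtain ⟨C1, hC10, hC1⟩ := exists_abs_le_of_continuous hK (hφ.continuous_fderiv_apply (e i))
      refine (hiV i).bdd_mul (c := C1 * C) ?_ ?_
      · exact (hφ.continuous_fderiv_apply _).aestronglyMeasurable.mul
          (hβc.comp_aestronglyMeasurable hav.integrableOn.aestronglyMeasurable)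
      · refine (ae_restrict_iff' hK.measurableSet).2 (.of_forall fun x hx => ?_)
        rw [Real.norm_eq_abs, abs_mul]
        exact mul_le_mul (hC1 x hx) (hC _) (abs_nonneg _) hC10
  · simp only [EuclideanSpace.norm_sq_eq, Real.norm_eq_abs, sq_abs]

/-! ### Limits, restriction and uniqueness of weak gradients -/

/-- `∫_U V · ∇φ ≤ ∫_U F φ` for all nonnegative test functions `φ` on `U`. -/
def IsSubsolutionGradient (U : Set 𝔼) (V : 𝔼 → 𝔼) (F : 𝔼 → ℝ) : Prop :=
  ∀ φ : 𝔼 → ℝ, IsTestFunction U φ → (∀ x, 0 ≤ φ x) →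
    ∫ x in U, inner ℝ (V x) (∇ φ x) ≤ ∫ x in U, F x * φ x

lemma ae_restrict_of_mem {U : Set 𝔼} (hU : MeasurableSet U) {p : 𝔼 → Prop}
    (h : ∀ x ∈ U, p x) : ∀ᵐ x ∂volume.restrict U, p x :=
  (ae_restrict_iff' hU).2 (.of_forall h)

lemma locallyIntegrableOn_of_bound {G : Type*} [NormedAddCommGroup G] {U : Set 𝔼} (hU : IsOpen U)
    {f : 𝔼 → G} (hf : AEStronglyMeasurable f (volume.restrict U)) {g : 𝔼 → ℝ}
    (hg : LocallyIntegrableOn g U) (hfg : ∀ x ∈ U, ‖f x‖ ≤ g x) : LocallyIntegrableOn f U := by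
  rw [locallyIntegrableOn_iff hU.isLocallyClosed] at hg ⊢
  exact fun K hKU hK => (hg K hKU hK).mono' (hf.mono_measure (Measure.restrict_mono hKU le_rfl))
    (ae_restrict_of_mem hK.measurableSet fun x hx => hfg x (hKU hx))

lemma IsTestFunction.integrableOn_mul {U : Set 𝔼} (hU : IsOpen U) {φ : 𝔼 → ℝ}
    (hφ : IsTestFunction U φ) {f g : 𝔼 → ℝ} (hf : LocallyIntegrableOn f U) (hg : Continuous g)
    (hg0 : ∀ x ∉ tsupport φ, g x = 0) : IntegrableOn (fun x => f x * g x) U :=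
  integrableOn_mul_of_vanish hU.measurableSet hφ.2.1
    ((hf.mono_set hφ.2.2).integrableOn_isCompact hφ.2.1) hg hg0

lemma IsTestFunction.integrableOn_inner {U : Set 𝔼} (hU : IsOpen U) {φ : 𝔼 → ℝ}
    (hφ : IsTestFunction U φ) {V : 𝔼 → 𝔼} (hV : LocallyIntegrableOn V U) :
    IntegrableOn (fun x => inner ℝ (V x) (∇ φ x)) U := by
  simp only [inner_eq_sum, gradient_coord]
  exact integrable_finsetSum _ fun i _ => hφ.integrableOn_mul hU (LocallyIntegrableOn.coord hU hV i)
    (hφ.continuous_fderiv_apply _) fun x hx => by simp [fderiv_eq_zero_of_notMem_tsupport hx]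

lemma tendsto_setIntegral_mul {U : Set 𝔼} (hU : IsOpen U) {φ : 𝔼 → ℝ} (hφ : IsTestFunction U φ)
    {g : 𝔼 → ℝ} (hg : Continuous g) (hg0 : ∀ x ∉ tsupport φ, g x = 0) {w : ℕ → 𝔼 → ℝ}
    {w' b : 𝔼 → ℝ} (hw : ∀ j, LocallyIntegrableOn (w j) U) (hb : LocallyIntegrableOn b U)
    (hwb : ∀ j, ∀ x ∈ U, |w j x| ≤ b x)
    (hlim : ∀ x ∈ U, Tendsto (fun j => w j x) atTop (𝓝 (w' x))) :
    Tendsto (fun j => ∫ x in U, w j x * g x) atTop (𝓝 (∫ x in U, w' x * g x)) := by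
  refine tendsto_integral_of_dominated_convergence (fun x => b x * |g x|)
    (fun j => (hφ.integrableOn_mul hU (hw j) hg hg0).aestronglyMeasurable)
    (hφ.integrableOn_mul hU hb hg.abs fun x hx => by simp [hg0 x hx])
    (fun j => ae_restrict_of_mem hU.measurableSet fun x hx => ?_)
    (ae_restrict_of_mem hU.measurableSet fun x hx => (hlim x hx).mul_const _)
  rw [Real.norm_eq_abs, abs_mul]
  exact mul_le_mul_of_nonneg_right (hwb j x hx) (abs_nonneg _)

lemma locallyIntegrableOn_of_tendsto {G : Type*} [NormedAddCommGroup G] {U : Set 𝔼}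
    (hU : IsOpen U) {w : ℕ → 𝔼 → G} {w' : 𝔼 → G} {b : 𝔼 → ℝ}
    (hw : ∀ j, LocallyIntegrableOn (w j) U) (hb : LocallyIntegrableOn b U)
    (hwb : ∀ j, ∀ x ∈ U, ‖w j x‖ ≤ b x)
    (hlim : ∀ x ∈ U, Tendsto (fun j => w j x) atTop (𝓝 (w' x))) : LocallyIntegrableOn w' U :=
  locallyIntegrableOn_of_bound hU
    (aestronglyMeasurable_of_tendsto_ae atTop (fun j => (hw j).aestronglyMeasurable)
      (ae_restrict_of_mem hU.measurableSet hlim)) hb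
    fun x hx => le_of_tendsto' (hlim x hx).norm fun j => hwb j x hx

/-- Dominated convergence on the support of each test function: locally integrable majorants
suffice, and no square integrability is needed. -/
lemma HasWeakGradient.of_tendsto {U : Set 𝔼} (hU : IsOpen U) {w : ℕ → 𝔼 → ℝ}
    {W : ℕ → 𝔼 → 𝔼} {v b b' : 𝔼 → ℝ} {V : 𝔼 → 𝔼} (hw : ∀ j, HasWeakGradient U (w j) (W j))
    (hb : LocallyIntegrableOn b U) (hwb : ∀ j, ∀ x ∈ U, |w j x| ≤ b x)
    (hlim : ∀ x ∈ U, Tendsto (fun j => w j x) atTop (𝓝 (v x)))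
    (hb' : LocallyIntegrableOn b' U) (hWb : ∀ j, ∀ x ∈ U, ‖W j x‖ ≤ b' x)
    (hlim' : ∀ x ∈ U, Tendsto (fun j => W j x) atTop (𝓝 (V x))) : HasWeakGradient U v V := by
  refine ⟨locallyIntegrableOn_of_tendsto hU (fun j => (hw j).1) hb hwb hlim,
    locallyIntegrableOn_of_tendsto hU (fun j => (hw j).2.1) hb' hWb hlim', fun φ hφ i => ?_⟩
  have h1 := tendsto_setIntegral_mul hU hφ (hφ.continuous_fderiv_apply (EuclideanSpace.single i 1))
    (fun x hx => by simp [fderiv_eq_zero_of_notMem_tsupport hx]) (fun j => (hw j).1) hb hwb hlim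
  have h2 := tendsto_setIntegral_mul hU hφ hφ.1.continuous
    (fun x hx => eq_zero_of_notMem_tsupport hx)
    (fun j => LocallyIntegrableOn.coord hU (hw j).2.1 i) hb'
    (fun j x hx => (PiLp.norm_apply_le (W j x) i).trans (hWb j x hx))
    (fun x hx => ((EuclideanSpace.proj (𝕜 := ℝ) i).continuous.tendsto _).comp (hlim' x hx))
  refine tendsto_nhds_unique (l := atTop) (f := fun j => ∫ x in U, w j x * (∇ φ x) i) ?_ ?_
  · simpa only [gradient_coord] using h1
  · simp only [fun j => (hw j).2.2 φ hφ i, mul_comm (φ _)]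
    exact h2.neg

lemma IsSubsolutionGradient.of_tendsto {U : Set 𝔼} (hU : IsOpen U)
    {W : ℕ → 𝔼 → 𝔼} {F b' : 𝔼 → ℝ} {V : 𝔼 → 𝔼} (hw : ∀ j, IsSubsolutionGradient U (W j) F)
    (hW : ∀ j, LocallyIntegrableOn (W j) U)
    (hb' : LocallyIntegrableOn b' U) (hWb : ∀ j, ∀ x ∈ U, ‖W j x‖ ≤ b' x)
    (hlim' : ∀ x ∈ U, Tendsto (fun j => W j x) atTop (𝓝 (V x))) :
    IsSubsolutionGradient U V F := by
  intro φ hφ hφ0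
  refine le_of_tendsto' (x := atTop) ?_ fun j => hw j φ hφ hφ0
  refine tendsto_integral_of_dominated_convergence (fun x => b' x * ‖∇ φ x‖)
    (fun j => (hφ.integrableOn_inner hU (hW j)).aestronglyMeasurable)
    (hφ.integrableOn_mul hU hb' hφ.continuous_gradient.norm fun x hx => by
      simp [gradient_eq_zero_of_notMem_tsupport hx])
    (fun j => ae_restrict_of_mem hU.measurableSet fun x hx => ?_)
    (ae_restrict_of_mem hU.measurableSet fun x hx => (hlim' x hx).inner tendsto_const_nhds)
  exact (norm_inner_le_norm _ _).trans (mul_le_mul_of_nonneg_right (hWb j x hx) (norm_nonneg _))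

lemma HasWeakGradient.congr {U : Set 𝔼} {v v' : 𝔼 → ℝ} {V V' : 𝔼 → 𝔼}
    (h : HasWeakGradient U v V) (hv : v =ᵐ[volume.restrict U] v')
    (hV : V =ᵐ[volume.restrict U] V') : HasWeakGradient U v' V' := by
  refine ⟨h.1.congr hv, h.2.1.congr hV, fun φ hφ i => ?_⟩
  have h1 : ∫ x in U, v x * (∇ φ x) i = ∫ x in U, v' x * (∇ φ x) i :=
    integral_congr_ae (hv.mono fun x hx => by simp only [hx])
  have h2 : ∫ x in U, φ x * V x i = ∫ x in U, φ x * V' x i :=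
    integral_congr_ae (hV.mono fun x hx => by simp only [hx])
  rw [← h1, ← h2, h.2.2 φ hφ i]

lemma IsSubsolutionGradient.congr {U : Set 𝔼} {F F' : 𝔼 → ℝ} {V V' : 𝔼 → 𝔼}
    (h : IsSubsolutionGradient U V F) (hV : V =ᵐ[volume.restrict U] V')
    (hF : F =ᵐ[volume.restrict U] F') : IsSubsolutionGradient U V' F' := by
  intro φ hφ hφ0
  have h1 : ∫ x in U, inner ℝ (V x) (∇ φ x) = ∫ x in U, inner ℝ (V' x) (∇ φ x) :=
    integral_congr_ae (hV.mono fun x hx => by simp only [hx])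
  have h2 : ∫ x in U, F x * φ x = ∫ x in U, F' x * φ x :=
    integral_congr_ae (hF.mono fun x hx => by simp only [hx])
  rw [← h1, ← h2]
  exact h φ hφ hφ0

lemma IsTestFunction.mono {U U' : Set 𝔼} (h : U ⊆ U') {φ : 𝔼 → ℝ} (hφ : IsTestFunction U φ) :
    IsTestFunction U' φ := ⟨hφ.1, hφ.2.1, hφ.2.2.trans h⟩

lemma setIntegral_eq_of_vanish {U U' : Set 𝔼} (hU : MeasurableSet U) (hU' : MeasurableSet U')
    {φ : 𝔼 → ℝ} (hφ : tsupport φ ⊆ U) (hφ' : tsupport φ ⊆ U') {g : 𝔼 → ℝ}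
    (hg : ∀ x ∉ tsupport φ, g x = 0) : ∫ x in U, g x = ∫ x in U', g x := by
  rw [setIntegral_eq_tsupport hU hφ hg, setIntegral_eq_tsupport hU' hφ' hg]

lemma IsTestFunction.setIntegral_gradient_eq {U U' : Set 𝔼} (hU : MeasurableSet U)
    (hU' : MeasurableSet U') {φ : 𝔼 → ℝ} (hφ : IsTestFunction U φ) (hφ' : IsTestFunction U' φ)
    (v : 𝔼 → ℝ) (i : Fin n) : ∫ x in U, v x * (∇ φ x) i = ∫ x in U', v x * (∇ φ x) i :=
  setIntegral_eq_of_vanish hU hU' hφ.2.2 hφ'.2.2 fun x hx => by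
    simp [gradient_eq_zero_of_notMem_tsupport hx]

lemma IsTestFunction.setIntegral_inner_eq {U U' : Set 𝔼} (hU : MeasurableSet U)
    (hU' : MeasurableSet U') {φ : 𝔼 → ℝ} (hφ : IsTestFunction U φ) (hφ' : IsTestFunction U' φ)
    (V : 𝔼 → 𝔼) : ∫ x in U, inner ℝ (V x) (∇ φ x) = ∫ x in U', inner ℝ (V x) (∇ φ x) :=
  setIntegral_eq_of_vanish hU hU' hφ.2.2 hφ'.2.2 fun x hx => by
    simp [gradient_eq_zero_of_notMem_tsupport hx]

lemma IsTestFunction.setIntegral_mul_eq {U U' : Set 𝔼} (hU : MeasurableSet U)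
    (hU' : MeasurableSet U') {φ : 𝔼 → ℝ} (hφ : IsTestFunction U φ) (hφ' : IsTestFunction U' φ)
    (v : 𝔼 → ℝ) : ∫ x in U, v x * φ x = ∫ x in U', v x * φ x :=
  setIntegral_eq_of_vanish hU hU' hφ.2.2 hφ'.2.2 fun x hx => by
    simp [eq_zero_of_notMem_tsupport hx]

lemma HasWeakGradient.mono {U U' : Set 𝔼} (hU : IsOpen U) (hU' : IsOpen U') (hUU' : U ⊆ U')
    {v : 𝔼 → ℝ} {V : 𝔼 → 𝔼} (h : HasWeakGradient U' v V) : HasWeakGradient U v V := by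
  refine ⟨h.1.mono_set hUU', h.2.1.mono_set hUU', fun φ hφ i => ?_⟩
  rw [hφ.setIntegral_gradient_eq hU.measurableSet hU'.measurableSet (hφ.mono hUU'),
    h.2.2 φ (hφ.mono hUU') i]
  simp only [mul_comm (φ _)]
  rw [hφ.setIntegral_mul_eq hU.measurableSet hU'.measurableSet (hφ.mono hUU')]

lemma IsSubsolutionGradient.mono {U U' : Set 𝔼} (hU : IsOpen U) (hU' : IsOpen U')
    (hUU' : U ⊆ U') {F : 𝔼 → ℝ} {V : 𝔼 → 𝔼} (h : IsSubsolutionGradient U' V F) :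
    IsSubsolutionGradient U V F := by
  intro φ hφ hφ0
  rw [hφ.setIntegral_inner_eq hU.measurableSet hU'.measurableSet (hφ.mono hUU'),
    hφ.setIntegral_mul_eq hU.measurableSet hU'.measurableSet (hφ.mono hUU')]
  exact h φ (hφ.mono hUU') hφ0

lemma HasWeakGradient.sub {U : Set 𝔼} (hU : IsOpen U) {v w : 𝔼 → ℝ} {V W : 𝔼 → 𝔼}
    (hv : HasWeakGradient U v V) (hw : HasWeakGradient U w W) :
    HasWeakGradient U (fun x => v x - w x) (fun x => V x - W x) := by
  refine ⟨hv.1.sub hw.1, hv.2.1.sub hw.2.1, fun φ hφ i => ?_⟩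
  have hg : ∀ {f : 𝔼 → ℝ}, LocallyIntegrableOn f U →
      IntegrableOn (fun x => f x * (∇ φ x) i) U := fun hf => by
    simp only [gradient_coord]
    exact hφ.integrableOn_mul hU hf (hφ.continuous_fderiv_apply _)
      fun x hx => by simp [fderiv_eq_zero_of_notMem_tsupport hx]
  have hm : ∀ {f : 𝔼 → 𝔼}, LocallyIntegrableOn f U →
      IntegrableOn (fun x => φ x * f x i) U := fun hf => by
    simp only [mul_comm (φ _)]
    exact hφ.integrableOn_mul hU (LocallyIntegrableOn.coord hU hf i) hφ.1.continuous
      fun x hx => eq_zero_of_notMem_tsupport hx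
  simp only [sub_mul, PiLp.sub_apply, mul_sub]
  rw [integral_sub (hg hv.1) (hg hw.1), integral_sub (hm hv.2.1) (hm hw.2.1), hv.2.2 φ hφ i,
    hw.2.2 φ hφ i]
  ring

/-- The difference is a weak gradient of zero, so each coordinate integrates to zero against all
test functions. This later identifies the gradient given by the boundary condition with the one
given in `Ω`. -/
lemma HasWeakGradient.ae_eq {U : Set 𝔼} (hU : IsOpen U) {v : 𝔼 → ℝ} {V W : 𝔼 → 𝔼}
    (hV : HasWeakGradient U v V) (hW : HasWeakGradient U v W) : V =ᵐ[volume.restrict U] W := by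
  have h0 := hV.sub hU hW
  have h : ∀ i : Fin n, ∀ᵐ x, x ∈ U → (V x - W x) i = 0 := by
    intro i
    refine hU.ae_eq_zero_of_integral_contDiff_smul_eq_zero
      (LocallyIntegrableOn.coord hU h0.2.1 i) fun φ h1 h2 h3 => ?_
    have h4 := h0.2.2 φ ⟨h1, h2, h3⟩ i
    simp only [sub_self, zero_mul, integral_zero, zero_eq_neg] at h4
    rw [integral_eq_tsupport (φ := φ) (fun x hx => by simp [eq_zero_of_notMem_tsupport hx]),
      ← setIntegral_eq_tsupport hU.measurableSet h3
        (fun x hx => by simp [eq_zero_of_notMem_tsupport hx])]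
    exact h4
  rw [Filter.EventuallyEq, ae_restrict_iff' hU.measurableSet]
  filter_upwards [ae_all_iff.2 h] with x hx hxU
  ext i
  have := hx i hxU
  simp only [PiLp.sub_apply] at this
  linarith

lemma hasWeakGradient_zero {U : Set 𝔼} : HasWeakGradient U (fun _ => 0) (fun _ => 0) :=
  ⟨locallyIntegrableOn_zero, locallyIntegrableOn_zero, fun φ _ i => by simp⟩

/-! ### Classical gradients and harmonic functions -/

lemma continuous_gradient_of_contDiff {h : 𝔼 → ℝ} (hh : ContDiff ℝ 1 h) : Continuous (∇ h) :=
  (InnerProductSpace.toDual ℝ 𝔼).symm.continuous.comp (hh.continuous_fderiv one_ne_zero)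

lemma integral_mul_fderiv_eq_neg {U : Set 𝔼} (hU : IsOpen U) {h φ : 𝔼 → ℝ}
    (hh : ContDiff ℝ 1 h) (hφ : IsTestFunction U φ) (e : 𝔼) :
    ∫ x in U, h x * fderiv ℝ φ x e = - ∫ x in U, fderiv ℝ h x e * φ x := by
  have hc : Continuous fun x => fderiv ℝ h x e :=
    (hh.continuous_fderiv one_ne_zero).clm_apply continuous_const
  have hd := hφ.continuous_fderiv_apply e
  have h1 : ∀ x ∉ tsupport φ, h x * fderiv ℝ φ x e = 0 := fun x hx => by
    simp [fderiv_eq_zero_of_notMem_tsupport hx]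
  have h2 : ∀ x ∉ tsupport φ, fderiv ℝ h x e * φ x = 0 := fun x hx => by
    simp [eq_zero_of_notMem_tsupport hx]
  have h3 : ∀ x ∉ tsupport φ, h x * φ x = 0 := fun x hx => by
    simp [eq_zero_of_notMem_tsupport hx]
  rw [setIntegral_eq_tsupport hU.measurableSet hφ.2.2 h1, ← integral_eq_tsupport h1,
    setIntegral_eq_tsupport hU.measurableSet hφ.2.2 h2, ← integral_eq_tsupport h2]
  exact integral_mul_fderiv_eq_neg_fderiv_mul_of_integrable
    (integrable_of_vanish hφ.2.1 (hc.mul hφ.1.continuous) h2)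
    (integrable_of_vanish hφ.2.1 (hh.continuous.mul hd) h1)
    (integrable_of_vanish hφ.2.1 (hh.continuous.mul hφ.1.continuous) h3)
    (fun x _ => hh.differentiable one_ne_zero x) (fun x _ => hφ.differentiable x)

lemma hasWeakGradient_of_contDiff {U : Set 𝔼} (hU : IsOpen U) {h : 𝔼 → ℝ}
    (hh : ContDiff ℝ 1 h) : HasWeakGradient U h (∇ h) := by
  refine ⟨hh.continuous.locallyIntegrable.locallyIntegrableOn _,
    (continuous_gradient_of_contDiff hh).locallyIntegrable.locallyIntegrableOn _, fun φ hφ i => ?_⟩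
  simp only [gradient_coord, mul_comm (φ _)]
  exact integral_mul_fderiv_eq_neg hU hh hφ _

/-- Integrating by parts in each coordinate moves the derivative off `φ`, and the sum of the results
is the integral of `-φ Δh`. -/
lemma integral_inner_gradient_eq_zero {U : Set 𝔼} (hU : IsOpen U) {h φ : 𝔼 → ℝ}
    (hh : InnerProductSpace.HarmonicOnNhd h univ) (hφ : IsTestFunction U φ) :
    ∫ x in U, inner ℝ (∇ h x) (∇ φ x) = 0 := by
  have hc : ContDiff ℝ 2 h := contDiffOn_univ.1 hh.contDiffOn
  have hfd : ∀ e : 𝔼, ContDiff ℝ 1 fun x => fderiv ℝ h x e := fun e =>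
    (hc.fderiv_right (m := 1) (by norm_num)).clm_apply contDiff_const
  simp only [inner_eq_sum, gradient_coord]
  rw [integral_finsetSum]
  · simp only [fun i => integral_mul_fderiv_eq_neg hU
      (hfd (EuclideanSpace.single i 1)) hφ (EuclideanSpace.single i 1)]
    rw [Finset.sum_neg_distrib, ← integral_finsetSum, neg_eq_zero]
    · refine integral_eq_zero_of_ae (.of_forall fun x => ?_)
      have hL := (hh x (mem_univ x)).2.self_of_nhds
      rw [InnerProductSpace.laplacian_eq_iteratedFDeriv_orthonormalBasis h
        (EuclideanSpace.basisFun (Fin n) ℝ)] at hL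
      simp only [iteratedFDeriv_two_apply, EuclideanSpace.basisFun_apply] at hL
      simp only [Pi.zero_apply, ← Finset.sum_mul]
      have h2 : ∀ e : 𝔼, fderiv ℝ (fun x => fderiv ℝ h x e) x e
          = fderiv ℝ (fderiv ℝ h) x e e := fun e => by
        rw [fderiv_clm_apply ((hc.fderiv_right (m := 1) (by norm_num)).differentiable
          one_ne_zero x) (differentiableAt_const e)]
        simp
      simp only [h2]
      simpa using Or.inl hL
    · exact fun i _ => hφ.integrableOn_mul hU
        ((((hfd _).continuous_fderiv one_ne_zero).clm_apply
          continuous_const).locallyIntegrable.locallyIntegrableOn _) hφ.1.continuous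
        fun x hx => eq_zero_of_notMem_tsupport hx
  · exact fun i _ => hφ.integrableOn_mul hU
      ((hfd _).continuous.locallyIntegrable.locallyIntegrableOn _) (hφ.continuous_fderiv_apply _)
      fun x hx => by simp [fderiv_eq_zero_of_notMem_tsupport hx]

/-! ### Positive parts of subsolutions -/

/-- The indicator of `(0, ∞)`. -/
noncomputable def heaviside (t : ℝ) : ℝ := if 0 < t then 1 else 0

lemma heaviside_of_pos {t : ℝ} (ht : 0 < t) : heaviside t = 1 := if_pos ht

lemma heaviside_of_nonpos {t : ℝ} (ht : t ≤ 0) : heaviside t = 0 := if_neg ht.not_gt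

lemma heaviside_nonneg (t : ℝ) : 0 ≤ heaviside t := by
  unfold heaviside; split_ifs <;> norm_num

/-- A smooth monotone approximation of `heaviside`. -/
noncomputable def smoothStep (N : ℕ) (t : ℝ) : ℝ := Real.smoothTransition ((N + 1) * t)

lemma smoothStep_nonneg (N : ℕ) (t : ℝ) : 0 ≤ smoothStep N t := Real.smoothTransition.nonneg _

lemma smoothStep_le_one (N : ℕ) (t : ℝ) : smoothStep N t ≤ 1 := Real.smoothTransition.le_one _

lemma abs_smoothStep_le_one (N : ℕ) (t : ℝ) : |smoothStep N t| ≤ 1 := by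
  rw [abs_of_nonneg (smoothStep_nonneg N t)]; exact smoothStep_le_one N t

lemma smoothStep_of_nonpos (N : ℕ) {t : ℝ} (ht : t ≤ 0) : smoothStep N t = 0 :=
  Real.smoothTransition.zero_of_nonpos (mul_nonpos_of_nonneg_of_nonpos (by positivity) ht)

lemma smoothStep_of_one_le {N : ℕ} {t : ℝ} (ht : 1 ≤ (N + 1) * t) : smoothStep N t = 1 :=
  Real.smoothTransition.one_of_one_le ht

lemma contDiff_smoothStep (N : ℕ) : ContDiff ℝ 1 (smoothStep N) :=
  (Real.smoothTransition.contDiff (n := 1)).comp (contDiff_const.mul contDiff_id)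

lemma continuous_smoothStep (N : ℕ) : Continuous (smoothStep N) := (contDiff_smoothStep N).continuous

lemma monotone_smoothStep (N : ℕ) : Monotone (smoothStep N) :=
  Real.smoothTransition.monotone.comp (monotone_mul_left_of_nonneg (by positivity))

lemma eventually_one_le_mul {s : ℕ → ℝ} {t : ℝ} (ht : 0 < t) (hs : Tendsto s atTop (𝓝 t)) :
    ∀ᶠ N : ℕ in atTop, 1 ≤ ((N : ℝ) + 1) * s N :=
  ((tendsto_natCast_atTop_atTop.atTop_add tendsto_const_nhds).atTop_mul_pos ht hs).eventually_ge_atTop 1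

/-- Convergence holds at every `t`, including `t = 0`, where both sides vanish. Hence the limiting
gradient `1_{v > 0} V` requires no separate study of the level set `{v = 0}`. -/
lemma tendsto_smoothStep (t : ℝ) :
    Tendsto (fun N => smoothStep N t) atTop (𝓝 (heaviside t)) := by
  rcases le_or_gt t 0 with ht | ht
  · simp only [smoothStep_of_nonpos _ ht, heaviside_of_nonpos ht, tendsto_const_nhds]
  · rw [heaviside_of_pos ht]
    refine tendsto_const_nhds.congr' ?_
    filter_upwards [eventually_one_le_mul ht tendsto_const_nhds] with N hN
      using (smoothStep_of_one_le hN).symm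

/-- The primitive of `smoothStep` vanishing at the origin, approximating `max t 0`. -/
noncomputable def ramp (N : ℕ) (t : ℝ) : ℝ := ∫ s in (0 : ℝ)..t, smoothStep N s

lemma hasDerivAt_primitive {β : ℝ → ℝ} (hβ : Continuous β) (t : ℝ) :
    HasDerivAt (fun t => ∫ s in (0 : ℝ)..t, β s) (β t) t :=
  intervalIntegral.integral_hasDerivAt_right (hβ.intervalIntegrable _ _)
    (hβ.stronglyMeasurableAtFilter _ _) hβ.continuousAt

lemma hasDerivAt_ramp (N : ℕ) (t : ℝ) : HasDerivAt (ramp N) (smoothStep N t) t :=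
  hasDerivAt_primitive (continuous_smoothStep N) t

lemma continuous_ramp (N : ℕ) : Continuous (ramp N) :=
  continuous_iff_continuousAt.2 fun t => (hasDerivAt_ramp N t).continuousAt

lemma abs_ramp_le (N : ℕ) (t : ℝ) : |ramp N t| ≤ |t| := by
  have := intervalIntegral.norm_integral_le_of_norm_le_const (a := 0) (b := t) (C := 1)
    (f := smoothStep N) fun s _ => abs_smoothStep_le_one N s
  simpa [ramp] using this

lemma ramp_nonneg (N : ℕ) (t : ℝ) : 0 ≤ ramp N t := by
  rcases le_total 0 t with ht | ht
  · exact intervalIntegral.integral_nonneg ht fun s _ => smoothStep_nonneg N s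
  · refine le_of_eq ?_
    rw [ramp, intervalIntegral.integral_congr (g := fun _ => 0)]
    · simp
    · intro s hs
      rw [uIcc_of_ge ht] at hs
      exact smoothStep_of_nonpos N hs.2

lemma tendsto_ramp (t : ℝ) : Tendsto (fun N => ramp N t) atTop (𝓝 (max t 0)) := by
  have h : Tendsto (fun N => ramp N t) atTop (𝓝 (∫ s in (0 : ℝ)..t, heaviside s)) := by
    refine intervalIntegral.tendsto_integral_filter_of_dominated_convergence (fun _ => 1)
      (.of_forall fun N => (continuous_smoothStep N).aestronglyMeasurable)
      (.of_forall fun N => .of_forall fun s _ => abs_smoothStep_le_one N s)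
      intervalIntegrable_const (.of_forall fun s _ => tendsto_smoothStep s)
  convert h using 2
  rcases le_total 0 t with ht | ht
  · rw [max_eq_left ht, intervalIntegral.integral_congr_ae (g := fun _ => 1)]
    · simp
    · refine .of_forall fun s hs => heaviside_of_pos ?_
      rw [uIoc_of_le ht] at hs
      exact hs.1
  · rw [max_eq_right ht, intervalIntegral.integral_congr (g := fun _ => 0)]
    · simp
    · intro s hs
      rw [uIcc_of_ge ht] at hs
      exact heaviside_of_nonpos hs.2

lemma norm_smul_le_of_abs_le_one {c : ℝ} (hc : |c| ≤ 1) (V : 𝔼) : ‖c • V‖ ≤ ‖V‖ := by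
  rw [norm_smul]
  exact mul_le_of_le_one_left (norm_nonneg _) hc

/-- The weak gradient of the positive part. -/
lemma HasWeakGradient.pos {U : Set 𝔼} (hU : IsOpen U) {v : 𝔼 → ℝ} {V : 𝔼 → 𝔼}
    (hv : HasWeakGradient U v V) :
    HasWeakGradient U (fun x => max (v x) 0) (fun x => heaviside (v x) • V x) :=
  HasWeakGradient.of_tendsto hU
    (fun N => hv.comp hU (hasDerivAt_ramp N) (continuous_smoothStep N) (abs_smoothStep_le_one N))
    hv.1.norm (fun N x _ => abs_ramp_le N (v x)) (fun x _ => tendsto_ramp (v x))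
    hv.2.1.norm (fun N _ _ => norm_smul_le_of_abs_le_one (abs_smoothStep_le_one N _) _)
    fun x _ => (tendsto_smoothStep (v x)).smul_const _

/-- The positive part of a subsolution is a subsolution. -/
lemma IsSubsolutionGradient.pos {U : Set 𝔼} (hU : IsOpen U) {v F : 𝔼 → ℝ} {V : 𝔼 → 𝔼}
    (hv : HasWeakGradient U v V) (hF : LocallyIntegrableOn F U)
    (hs : IsSubsolutionGradient U V F) :
    IsSubsolutionGradient U (fun x => heaviside (v x) • V x) (fun x => max (F x) 0) := by
  have hF' : LocallyIntegrableOn (fun x => max (F x) 0) U := by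
    refine locallyIntegrableOn_of_bound hU ?_ hF.norm fun x _ => ?_
    · exact (continuous_id.max continuous_const).comp_aestronglyMeasurable hF.aestronglyMeasurable
    · rw [Real.norm_of_nonneg (le_max_right _ _)]
      exact max_le (le_abs_self _) (abs_nonneg _)
  refine IsSubsolutionGradient.of_tendsto hU (W := fun N x => smoothStep N (v x) • V x)
    (fun N φ hφ hφ0 => ?_)
    (fun N => LocallyIntegrableOn.bdd_comp_smul hU hv.1 hv.2.1 (continuous_smoothStep N).measurable
      (abs_smoothStep_le_one N))
    hv.2.1.norm (fun N _ _ => norm_smul_le_of_abs_le_one (abs_smoothStep_le_one N _) _)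
    fun x _ => (tendsto_smoothStep (v x)).smul_const _
  -- The cap is `k = 0`, so the nonnegative quadratic term is simply dropped.
  have h := integral_comp_le_of_subsolution hU hv hF hs
    (fun t => ((contDiff_smoothStep N).differentiable one_ne_zero t).hasDerivAt)
    ((contDiff_smoothStep N).continuous_deriv_one) (fun t => (monotone_smoothStep N).deriv_nonneg)
    (abs_smoothStep_le_one N) (smoothStep_nonneg N) hφ hφ0 le_rfl
  have h0 : ∀ x, min (φ x * deriv (smoothStep N) (v x) * ‖V x‖ ^ 2) 0 = 0 := fun x =>
    min_eq_right (mul_nonneg (mul_nonneg (hφ0 x) (monotone_smoothStep N).deriv_nonneg)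
      (sq_nonneg _))
  simp only [h0, integral_zero, add_zero] at h
  simp only [real_inner_smul_left]
  refine h.trans (integral_mono_ae ?_ (hφ.integrableOn_mul hU hF' hφ.1.continuous
    fun x hx => eq_zero_of_notMem_tsupport hx) (.of_forall fun x => ?_))
  · have h1 := (hφ.integrableOn_mul hU hF hφ.1.continuous
      fun x hx => eq_zero_of_notMem_tsupport hx)
    refine (h1.bdd_mul (f := fun x => smoothStep N (v x)) (c := 1)
      ((continuous_smoothStep N).comp_aestronglyMeasurable hv.1.aestronglyMeasurable)
      (.of_forall fun x => abs_smoothStep_le_one N _)).congr (.of_forall fun x => ?_)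
    simp only; ring
  · simp only
    have h1 : smoothStep N (v x) * F x ≤ max (F x) 0 := by
      rcases le_total 0 (F x) with hx | hx
      · exact (mul_le_of_le_one_left hx (smoothStep_le_one _ _)).trans (le_max_left _ _)
      · exact (mul_nonpos_of_nonneg_of_nonpos (smoothStep_nonneg _ _) hx).trans (le_max_right _ _)
    nlinarith [mul_le_mul_of_nonneg_left h1 (hφ0 x)]

/-! ### Truncated Caccioppoli estimate -/

/-- A bounded approximation of `max t 0` with continuous nonnegative derivative. -/
noncomputable def boundedRamp (N : ℕ) (t : ℝ) : ℝ :=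
  (N + 1) * Real.arctan (ramp N t / (N + 1))

/-- The derivative of `boundedRamp`. -/
noncomputable def boundedRampDeriv (N : ℕ) (t : ℝ) : ℝ :=
  smoothStep N t / (1 + (ramp N t / (N + 1)) ^ 2)

lemma hasDerivAt_boundedRamp (N : ℕ) (t : ℝ) :
    HasDerivAt (boundedRamp N) (boundedRampDeriv N t) t := by
  have h := (((hasDerivAt_ramp N t).div_const ((N : ℝ) + 1)).arctan).const_mul ((N : ℝ) + 1)
  refine h.congr_deriv ?_
  have : (N : ℝ) + 1 ≠ 0 := by positivity
  rw [boundedRampDeriv]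
  field_simp

lemma continuous_boundedRamp (N : ℕ) : Continuous (boundedRamp N) :=
  continuous_iff_continuousAt.2 fun t => (hasDerivAt_boundedRamp N t).continuousAt

lemma continuous_boundedRampDeriv (N : ℕ) : Continuous (boundedRampDeriv N) :=
  (continuous_smoothStep N).div
    (continuous_const.add (((continuous_ramp N).div_const _).pow 2)) fun t => by positivity

lemma boundedRampDeriv_nonneg (N : ℕ) (t : ℝ) : 0 ≤ boundedRampDeriv N t :=
  div_nonneg (smoothStep_nonneg N t) (by positivity)

lemma boundedRamp_nonneg (N : ℕ) (t : ℝ) : 0 ≤ boundedRamp N t :=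
  mul_nonneg (by positivity) (Real.arctan_nonneg.2 (div_nonneg (ramp_nonneg N t) (by positivity)))

lemma boundedRamp_le_abs (N : ℕ) (t : ℝ) : boundedRamp N t ≤ |t| := by
  have h0 : 0 ≤ ramp N t / (N + 1) := div_nonneg (ramp_nonneg N t) (by positivity)
  have h1 : Real.arctan (ramp N t / (N + 1)) ≤ ramp N t / (N + 1) := by
    have := Real.le_tan (Real.arctan_nonneg.2 h0) (Real.arctan_lt_pi_div_two _)
    rwa [Real.tan_arctan] at this
  calc boundedRamp N t ≤ (N + 1) * (ramp N t / (N + 1)) :=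
        mul_le_mul_of_nonneg_left h1 (by positivity)
    _ = ramp N t := by field_simp
    _ ≤ |t| := (le_abs_self _).trans (abs_ramp_le N t)

lemma abs_boundedRamp_le (N : ℕ) (t : ℝ) : |boundedRamp N t| ≤ (N + 1) * (Real.pi / 2) := by
  rw [abs_of_nonneg (boundedRamp_nonneg N t)]
  exact mul_le_mul_of_nonneg_left (Real.arctan_lt_pi_div_two _).le (by positivity)

/-- Stated along a moving argument `s N → t`, because the energy bound is applied with the smoothing
index and the index of the approximating subsolution equal. -/
lemma tendsto_boundedRampDeriv {s : ℕ → ℝ} {t : ℝ} (ht : 0 < t) (hs : Tendsto s atTop (𝓝 t)) :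
    Tendsto (fun N => boundedRampDeriv N (s N)) atTop (𝓝 1) := by
  have h1 : Tendsto (fun N : ℕ => |s N| * (1 / ((N : ℝ) + 1))) atTop (𝓝 0) := by
    simpa using hs.abs.mul (tendsto_one_div_add_atTop_nhds_zero_nat (𝕜 := ℝ))
  have h2 : Tendsto (fun N : ℕ => ramp N (s N) / ((N : ℝ) + 1)) atTop (𝓝 0) := by
    refine squeeze_zero (fun N => div_nonneg (ramp_nonneg N _) (by positivity)) (fun N => ?_) h1
    rw [mul_one_div]
    gcongr
    exact (le_abs_self _).trans (abs_ramp_le N _)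
  have h3 : Tendsto (fun N => smoothStep N (s N)) atTop (𝓝 1) := by
    refine tendsto_const_nhds.congr' ?_
    filter_upwards [eventually_one_le_mul ht hs] with N hN using (smoothStep_of_one_le hN).symm
  have h4 := h3.div ((h2.pow 2).const_add 1) (by norm_num)
  rw [show (1 : ℝ) / (1 + 0 ^ 2) = 1 by norm_num] at h4
  exact h4

lemma IsTestFunction.fderiv_apply {U : Set 𝔼} {φ : 𝔼 → ℝ} (hφ : IsTestFunction U φ) (e : 𝔼) :
    IsTestFunction U (fun x => fderiv ℝ φ x e) := by
  have hs : tsupport (fun x => fderiv ℝ φ x e) ⊆ tsupport φ := by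
    refine closure_minimal (fun x hx => ?_) (isClosed_tsupport φ)
    by_contra h
    exact hx (by simp [fderiv_eq_zero_of_notMem_tsupport h])
  exact ⟨(hφ.1.fderiv_right (m := ∞) (by simp)).clm_apply contDiff_const,
    hφ.2.1.of_isClosed_subset (isClosed_tsupport _) hs, hs.trans hφ.2.2⟩

/-- The Laplacian of `φ` in coordinates. -/
noncomputable def coordLaplacian (φ : 𝔼 → ℝ) (x : 𝔼) : ℝ :=
  ∑ i : Fin n, fderiv ℝ (fun y => fderiv ℝ φ y (EuclideanSpace.single i 1)) x
    (EuclideanSpace.single i 1)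

lemma IsTestFunction.continuous_coordLaplacian {U : Set 𝔼} {φ : 𝔼 → ℝ}
    (hφ : IsTestFunction U φ) : Continuous (coordLaplacian φ) :=
  continuous_finsetSum _ fun _ _ => (hφ.fderiv_apply _).continuous_fderiv_apply _

lemma coordLaplacian_eq_zero {φ : 𝔼 → ℝ} {x : 𝔼} (hx : x ∉ tsupport φ) :
    coordLaplacian φ x = 0 := by
  refine Finset.sum_eq_zero fun i _ => ?_
  have h : (fun y => fderiv ℝ φ y (EuclideanSpace.single i 1)) =ᶠ[𝓝 x] fun _ => (0 : ℝ) := by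
    filter_upwards [(isClosed_tsupport φ).isOpen_compl.mem_nhds hx] with y hy
    simp [fderiv_eq_zero_of_notMem_tsupport hy]
  rw [h.fderiv_eq]
  simp

/-- Each `∂_i φ` is itself a test function; using it moves both derivatives onto `φ`, so that only
`v` has to be estimated. -/
lemma HasWeakGradient.integral_inner_eq {U : Set 𝔼} (hU : IsOpen U) {v φ : 𝔼 → ℝ} {V : 𝔼 → 𝔼}
    (hv : HasWeakGradient U v V) (hφ : IsTestFunction U φ) :
    ∫ x in U, inner ℝ (V x) (∇ φ x) = - ∫ x in U, v x * coordLaplacian φ x := by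
  have h : ∀ i : Fin n, ∫ x in U, V x i * fderiv ℝ φ x (EuclideanSpace.single i 1)
      = - ∫ x in U, v x * fderiv ℝ (fun y => fderiv ℝ φ y (EuclideanSpace.single i 1)) x
        (EuclideanSpace.single i 1) := fun i => by
    have := hv.2.2 _ (hφ.fderiv_apply (EuclideanSpace.single i 1)) i
    simp only [gradient_coord, mul_comm (fderiv ℝ φ _ _)] at this
    rw [this, neg_neg]
  simp only [inner_eq_sum, gradient_coord, coordLaplacian, Finset.mul_sum]
  rw [integral_finsetSum, integral_finsetSum, ← Finset.sum_neg_distrib]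
  · exact Finset.sum_congr rfl fun i _ => h i
  · intro i _
    have hψ := hφ.fderiv_apply (EuclideanSpace.single i 1)
    exact hψ.integrableOn_mul hU hv.1 (hψ.continuous_fderiv_apply (EuclideanSpace.single i 1))
      fun x hx => by simp [fderiv_eq_zero_of_notMem_tsupport hx]
  · exact fun i _ => hφ.integrableOn_mul hU (LocallyIntegrableOn.coord hU hv.2.1 i)
      (hφ.continuous_fderiv_apply _) fun x hx => by simp [fderiv_eq_zero_of_notMem_tsupport hx]

/-- A bound independent of `N`, which makes the cross term of the energy estimate controllable by an
L² majorant of `v`. -/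
lemma abs_primitive_boundedRamp_le (N : ℕ) (t : ℝ) :
    |∫ s in (0 : ℝ)..t, boundedRamp N s| ≤ t ^ 2 := by
  have h := intervalIntegral.norm_integral_le_of_norm_le_const (a := 0) (b := t) (C := |t|)
    (f := boundedRamp N) fun s hs => by
      rw [Real.norm_of_nonneg (boundedRamp_nonneg N s)]
      refine (boundedRamp_le_abs N s).trans ?_
      rcases le_total 0 t with ht | ht
      · rw [uIoc_of_le ht] at hs
        rw [abs_of_pos hs.1, abs_of_nonneg ht]; exact hs.2
      · rw [uIoc_of_ge ht] at hs
        rw [abs_of_nonpos hs.2, abs_of_nonpos ht]; linarith [hs.1]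
  simpa [← sq] using h

/-- A truncated Caccioppoli estimate for nonnegative subsolutions. -/
lemma truncated_energy_le {U : Set 𝔼} (hU : IsOpen U) {v w F : 𝔼 → ℝ} {V : 𝔼 → 𝔼}
    (hv : HasWeakGradient U v V) (hF : LocallyIntegrableOn F U)
    (hs : IsSubsolutionGradient U V F) (hF0 : ∀ x ∈ U, 0 ≤ F x)
    (hvw : ∀ x ∈ U, |v x| ≤ w x) (hwF : LocallyIntegrableOn (fun x => w x * F x) U)
    (hw2 : LocallyIntegrableOn (fun x => w x ^ 2) U)
    {φ : 𝔼 → ℝ} (hφ : IsTestFunction U φ) (hφ0 : ∀ x, 0 ≤ φ x) (N : ℕ) :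
    ∫ x in U, min (φ x * boundedRampDeriv N (v x) * ‖V x‖ ^ 2) N
      ≤ (∫ x in U, w x * F x * φ x) + ∫ x in U, w x ^ 2 * |coordLaplacian φ x| := by
  have hUm := hU.measurableSet
  have h := integral_comp_le_of_subsolution hU hv hF hs (hasDerivAt_boundedRamp N)
    (continuous_boundedRampDeriv N) (boundedRampDeriv_nonneg N) (abs_boundedRamp_le N)
    (boundedRamp_nonneg N) hφ hφ0 (Nat.cast_nonneg N)
  -- With `B` the primitive of `β`, the field `β(v) V` is the weak gradient of `B(v)`. The cross
  -- term thus becomes `-∫ B(v) Δφ`, and nothing has to be absorbed into the quadratic term.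
  have hg := hv.comp hU (hasDerivAt_primitive (continuous_boundedRamp N))
    (continuous_boundedRamp N) (abs_boundedRamp_le N)
  have h2 := hg.integral_inner_eq hU hφ
  simp only [real_inner_smul_left] at h2
  rw [h2] at h
  have hlap : ∀ x ∉ tsupport φ, coordLaplacian φ x = 0 := fun x hx => coordLaplacian_eq_zero hx
  have h3 : ∫ x in U, (∫ s in (0 : ℝ)..v x, boundedRamp N s) * coordLaplacian φ x
      ≤ ∫ x in U, w x ^ 2 * |coordLaplacian φ x| := by
    refine setIntegral_mono_on
      (hφ.integrableOn_mul hU hg.1 hφ.continuous_coordLaplacian hlap)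
      (hφ.integrableOn_mul hU hw2 hφ.continuous_coordLaplacian.abs fun x hx => by
        simp [hlap x hx]) hUm fun x hx => ?_
    refine (le_abs_self _).trans ?_
    rw [abs_mul]
    refine mul_le_mul_of_nonneg_right ((abs_primitive_boundedRamp_le N _).trans ?_) (abs_nonneg _)
    rw [← sq_abs]
    exact pow_le_pow_left₀ (abs_nonneg _) (hvw x hx) 2
  have h4 : ∫ x in U, φ x * boundedRamp N (v x) * F x ≤ ∫ x in U, w x * F x * φ x := by
    refine setIntegral_mono_on ?_ (hφ.integrableOn_mul hU hwF hφ.1.continuous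
      fun x hx => eq_zero_of_notMem_tsupport hx) hUm fun x hx => ?_
    · have h1 := (hφ.integrableOn_mul hU hF hφ.1.continuous
        fun x hx => eq_zero_of_notMem_tsupport hx)
      refine (h1.bdd_mul (f := fun x => boundedRamp N (v x))
        ((continuous_boundedRamp N).comp_aestronglyMeasurable hv.1.aestronglyMeasurable)
        (.of_forall fun x => abs_boundedRamp_le N _)).congr (.of_forall fun x => ?_)
      ring
    · have h5 : boundedRamp N (v x) * (F x * φ x) ≤ w x * (F x * φ x) :=
        mul_le_mul_of_nonneg_right ((boundedRamp_le_abs N _).trans (hvw x hx))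
          (mul_nonneg (hF0 x hx) (hφ0 x))
      linarith
  linarith

/-- Limits of nonnegative subsolutions with a common `L²_loc` majorant have finite local energy. -/
lemma lintegral_energy_lt_top {U : Set 𝔼} (hU : IsOpen U) {w F : 𝔼 → ℝ} {v : ℕ → 𝔼 → ℝ}
    {V : ℕ → 𝔼 → 𝔼} {G : 𝔼 → 𝔼} (hv : ∀ j, HasWeakGradient U (v j) (V j))
    (hF : LocallyIntegrableOn F U)
    (hs : ∀ j, IsSubsolutionGradient U (V j) F) (hF0 : ∀ x ∈ U, 0 ≤ F x)
    (hvw : ∀ j, ∀ x ∈ U, |v j x| ≤ w x) (hwF : LocallyIntegrableOn (fun x => w x * F x) U)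
    (hw2 : LocallyIntegrableOn (fun x => w x ^ 2) U)
    (hlim : ∀ x ∈ U, Tendsto (fun j => v j x) atTop (𝓝 (w x)))
    (hlim' : ∀ x ∈ U, Tendsto (fun j => V j x) atTop (𝓝 (G x)))
    (hG : ∀ x ∈ U, w x ≤ 0 → G x = 0)
    {φ : 𝔼 → ℝ} (hφ : IsTestFunction U φ) (hφ0 : ∀ x, 0 ≤ φ x) :
    ∫⁻ x in tsupport φ, ENNReal.ofReal (φ x * ‖G x‖ ^ 2) < ⊤ := by
  have hUm := hU.measurableSet
  have hK : IsCompact (tsupport φ) := hφ.2.1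
  have hKfin : IsFiniteMeasure (volume.restrict (tsupport φ)) :=
    ⟨by simpa using hK.measure_lt_top⟩
  -- A diagonal choice: `N` is at once the index of the subsolution, the smoothing parameter and the
  -- cap.
  let q : ℕ → 𝔼 → ℝ := fun N x => min (φ x * boundedRampDeriv N (v N x) * ‖V N x‖ ^ 2) N
  have hq0 : ∀ N x, 0 ≤ q N x := fun N x => le_min (mul_nonneg (mul_nonneg (hφ0 x)
    (boundedRampDeriv_nonneg N _)) (sq_nonneg _)) (Nat.cast_nonneg N)
  have hqm : ∀ N, AEStronglyMeasurable (q N) (volume.restrict (tsupport φ)) := fun N => by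
    have hm := Measure.restrict_mono hφ.2.2 (le_refl (volume : Measure 𝔼))
    have h1 := (hv N).1.aestronglyMeasurable.mono_measure hm
    have h2 := (hv N).2.1.aestronglyMeasurable.mono_measure hm
    exact ((hφ.1.continuous.aestronglyMeasurable.mul
      ((continuous_boundedRampDeriv N).comp_aestronglyMeasurable h1)).mul
      (h2.norm.pow 2)).inf aestronglyMeasurable_const
  have hqi : ∀ N, IntegrableOn (q N) (tsupport φ) := fun N =>
    Integrable.of_bound (hqm N) N (.of_forall fun x => by
      rw [Real.norm_of_nonneg (hq0 N x)]; exact min_le_right _ _)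
  set C := (∫ x in U, w x * F x * φ x) + ∫ x in U, w x ^ 2 * |coordLaplacian φ x|
  have hqC : ∀ N, ∫⁻ x in tsupport φ, ENNReal.ofReal (q N x) ≤ ENNReal.ofReal C := fun N => by
    rw [← ofReal_integral_eq_lintegral_ofReal (hqi N) (.of_forall (hq0 N))]
    refine ENNReal.ofReal_le_ofReal ?_
    rw [← setIntegral_eq_tsupport hUm hφ.2.2 (g := q N)
      (fun x hx => by simp [q, eq_zero_of_notMem_tsupport hx])]
    exact truncated_energy_le hU (hv N) hF (hs N) hF0 (hvw N) hwF hw2 hφ hφ0 N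
  refine lt_of_le_of_lt ?_ (ENNReal.ofReal_lt_top (r := C))
  calc ∫⁻ x in tsupport φ, ENNReal.ofReal (φ x * ‖G x‖ ^ 2)
      ≤ ∫⁻ x in tsupport φ, liminf (fun N => ENNReal.ofReal (q N x)) atTop := by
        refine lintegral_mono_ae (ae_restrict_of_mem hK.measurableSet fun x hxK => ?_)
        have hx : x ∈ U := hφ.2.2 hxK
        -- Where `w ≤ 0` the slopes need not tend to 1, but `G` vanishes. Where `w > 0` the uncapped
        -- expression has a finite limit, so the cap `N` is eventually inactive.
        rcases le_or_gt (w x) 0 with hwx | hwx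
        · simp [hG x hx hwx]
        · have h1 : Tendsto (fun N => φ x * boundedRampDeriv N (v N x) * ‖V N x‖ ^ 2) atTop
              (𝓝 (φ x * 1 * ‖G x‖ ^ 2)) :=
            ((tendsto_boundedRampDeriv hwx (hlim x hx)).const_mul _).mul ((hlim' x hx).norm.pow 2)
          rw [mul_one] at h1
          have h2 : Tendsto (fun N => q N x) atTop (𝓝 (φ x * ‖G x‖ ^ 2)) := by
            refine h1.congr' ?_
            filter_upwards [h1.eventually_lt_const (lt_add_one _),
              tendsto_natCast_atTop_atTop.eventually_ge_atTop (φ x * ‖G x‖ ^ 2 + 1)] with N hN hN'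
            exact (min_eq_left (hN.le.trans hN')).symm
          exact ((ENNReal.continuous_ofReal.tendsto _).comp h2).liminf_eq.ge
    _ ≤ liminf (fun N => ∫⁻ x in tsupport φ, ENNReal.ofReal (q N x)) atTop :=
        lintegral_liminf_le' fun N => (hqm N).aemeasurable.ennreal_ofReal
    _ ≤ ENNReal.ofReal C := liminf_le_of_le (by isBoundedDefault) fun b hb => by
        obtain ⟨N, hN⟩ := hb.exists
        exact hN.trans (hqC N)

/-! ### Cutoffs, partitions of unity and localisation -/

lemma exists_testFunction_eq_one {U K : Set 𝔼} (hU : IsOpen U) (hK : IsCompact K) (hKU : K ⊆ U) :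
    ∃ φ : 𝔼 → ℝ, IsTestFunction U φ ∧ (∀ x, 0 ≤ φ x) ∧ ∀ x ∈ K, φ x = 1 := by
  obtain ⟨δ, hδ, hδU⟩ := hK.exists_cthickening_subset_open hU hKU
  obtain ⟨φ, h1, h2, h3, h4⟩ := exists_contMDiff_support_eq_eq_one_iff
    (modelWithCornersSelf ℝ 𝔼) (n := ⊤) (isOpen_thickening (δ := δ) (E := K)) hK.isClosed
    (self_subset_thickening hδ K)
  have hs : tsupport φ ⊆ cthickening δ K := by
    rw [tsupport, h3]; exact closure_thickening_subset_cthickening δ K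
  exact ⟨φ, ⟨h1.contDiff, hK.cthickening.of_isClosed_subset (isClosed_tsupport _) hs,
    hs.trans hδU⟩, fun x => (h2 (mem_range_self x)).1, fun x hx => (h4 x).1 hx⟩

/-- Multiply `φ` by a partition of unity subordinate to a finite subcover of its support. The
weights are nonnegative, so weak inequalities, and not only identities, can be glued. -/
lemma IsTestFunction.exists_decomposition {U : Set 𝔼} {φ : 𝔼 → ℝ} (hφ : IsTestFunction U φ)
    {N : 𝔼 → Set 𝔼} (hN : ∀ x ∈ U, IsOpen (N x)) (hxN : ∀ x ∈ U, x ∈ N x) :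
    ∃ (t : Finset 𝔼) (ψ : t → 𝔼 → ℝ), (∀ i : t, i.1 ∈ U) ∧
      (∀ i : t, IsTestFunction U (ψ i)) ∧ (∀ i : t, IsTestFunction (N i) (ψ i)) ∧
      (φ = fun x => ∑ i, ψ i x) ∧ ((∀ x, 0 ≤ φ x) → ∀ i x, 0 ≤ ψ i x) := by
  have hK : IsCompact (tsupport φ) := hφ.2.1
  obtain ⟨t, htU⟩ := hK.elim_nhds_subcover' (fun x _ => N x)
    fun x hx => (hN x (hφ.2.2 hx)).mem_nhds (hxN x (hφ.2.2 hx))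
  classical
  let s : Finset 𝔼 := t.image Subtype.val
  have hsU : ∀ i : s, i.1 ∈ U := fun i => by
    obtain ⟨y, -, hy⟩ := Finset.mem_image.1 i.2
    exact hy ▸ hφ.2.2 y.2
  have hcov : tsupport φ ⊆ ⋃ i : s, N i := fun x hx => by
    obtain ⟨y, hy, hxy⟩ := mem_iUnion₂.1 (htU hx)
    exact mem_iUnion.2 ⟨⟨y, Finset.mem_image_of_mem _ hy⟩, hxy⟩
  obtain ⟨f, hf⟩ := SmoothPartitionOfUnity.exists_isSubordinate (modelWithCornersSelf ℝ 𝔼)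
    (isClosed_tsupport φ) (fun i : s => N i) (fun i => hN _ (hsU i)) hcov
  have hc : ∀ i, ContDiff ℝ ∞ fun x => f i x * φ x := fun i =>
    ((f i).contMDiff.contDiff).mul hφ.1
  have hs1 : ∀ i, tsupport (fun x => f i x * φ x) ⊆ tsupport φ := fun i => tsupport_mul_subset_right
  have hs2 : ∀ i, tsupport (fun x => f i x * φ x) ⊆ N i := fun i =>
    tsupport_mul_subset_left.trans (hf i)
  have hcs : ∀ i, HasCompactSupport fun x => f i x * φ x := fun i =>
    hK.of_isClosed_subset (isClosed_tsupport _) (hs1 i)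
  refine ⟨s, fun i x => f i x * φ x, hsU, fun i => ⟨hc i, hcs i, (hs1 i).trans hφ.2.2⟩,
    fun i => ⟨hc i, hcs i, hs2 i⟩, ?_, fun h i x => mul_nonneg (f.nonneg i x) (h x)⟩
  funext x
  rw [← Finset.sum_mul]
  by_cases hx : x ∈ tsupport φ
  · have := f.sum_eq_one hx
    rw [finsum_eq_sum_of_fintype] at this
    rw [this, one_mul]
  · rw [eq_zero_of_notMem_tsupport hx, mul_zero]

lemma gradient_sum {ι : Type*} [Fintype ι] {U : Set 𝔼} {ψ : ι → 𝔼 → ℝ}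
    (hψ : ∀ i, IsTestFunction U (ψ i)) (x : 𝔼) :
    ∇ (fun x => ∑ i, ψ i x) x = ∑ i, ∇ (ψ i) x := by
  simp only [gradient]
  rw [fderiv_fun_sum fun i _ => (hψ i).differentiable x, map_sum]

lemma locallyIntegrableOn_of_local {G : Type*} [NormedAddCommGroup G] {U : Set 𝔼} {f : 𝔼 → G}
    (h : ∀ x ∈ U, ∃ N, IsOpen N ∧ x ∈ N ∧ LocallyIntegrableOn f N) :
    LocallyIntegrableOn f U := by
  intro x hx
  obtain ⟨N, hN, hxN, hf⟩ := h x hx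
  have := hf x hxN
  rw [hN.nhdsWithin_eq hxN] at this
  exact this.filter_mono nhdsWithin_le_nhds

lemma HasWeakGradient.of_local {U : Set 𝔼} (hU : IsOpen U) {v : 𝔼 → ℝ} {V : 𝔼 → 𝔼}
    (h : ∀ x ∈ U, ∃ N, IsOpen N ∧ x ∈ N ∧ HasWeakGradient N v V) : HasWeakGradient U v V := by
  choose! N hNo hxN hN using h
  have hv : LocallyIntegrableOn v U := locallyIntegrableOn_of_local fun x hx =>
    ⟨N x, hNo x hx, hxN x hx, (hN x hx).1⟩
  have hV : LocallyIntegrableOn V U := locallyIntegrableOn_of_local fun x hx =>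
    ⟨N x, hNo x hx, hxN x hx, (hN x hx).2.1⟩
  refine ⟨hv, hV, fun φ hφ i => ?_⟩
  obtain ⟨t, ψ, htU, hψU, hψN, rfl, -⟩ := hφ.exists_decomposition hNo hxN
  simp only [gradient_sum hψU, WithLp.ofLp_sum, Finset.sum_apply, Finset.mul_sum, Finset.sum_mul]
  rw [integral_finsetSum, integral_finsetSum, ← Finset.sum_neg_distrib]
  · refine Finset.sum_congr rfl fun j _ => ?_
    have h1 := (hN j (htU j)).2.2 (ψ j) (hψN j) i
    have hm := (hNo j (htU j)).measurableSet
    simp only [mul_comm (ψ j _)] at h1 ⊢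
    rwa [(hψU j).setIntegral_gradient_eq hU.measurableSet hm (hψN j),
      (hψU j).setIntegral_mul_eq hU.measurableSet hm (hψN j)]
  · intro j _
    simp only [mul_comm (ψ j _)]
    exact (hψU j).integrableOn_mul hU (LocallyIntegrableOn.coord hU hV i) (hψU j).1.continuous
      fun x hx => eq_zero_of_notMem_tsupport hx
  · intro j _
    simp only [gradient_coord]
    exact (hψU j).integrableOn_mul hU hv ((hψU j).continuous_fderiv_apply _)
      fun x hx => by simp [fderiv_eq_zero_of_notMem_tsupport hx]

lemma IsSubsolutionGradient.of_local {U : Set 𝔼} (hU : IsOpen U) {V : 𝔼 → 𝔼} {F : 𝔼 → ℝ}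
    (hV : LocallyIntegrableOn V U) (hF : LocallyIntegrableOn F U)
    (h : ∀ x ∈ U, ∃ N, IsOpen N ∧ x ∈ N ∧ IsSubsolutionGradient N V F) :
    IsSubsolutionGradient U V F := by
  choose! N hNo hxN hN using h
  intro φ hφ hφ0
  obtain ⟨t, ψ, htU, hψU, hψN, rfl, hψ0⟩ := hφ.exists_decomposition hNo hxN
  simp only [gradient_sum hψU, inner_sum, Finset.mul_sum]
  rw [integral_finsetSum, integral_finsetSum]
  · refine Finset.sum_le_sum fun j _ => ?_
    have hm := (hNo j (htU j)).measurableSet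
    rw [(hψU j).setIntegral_inner_eq hU.measurableSet hm (hψN j),
      (hψU j).setIntegral_mul_eq hU.measurableSet hm (hψN j)]
    exact hN j (htU j) (ψ j) (hψN j) (hψ0 hφ0 j)
  · exact fun j _ => (hψU j).integrableOn_mul hU hF (hψU j).1.continuous
      fun x hx => eq_zero_of_notMem_tsupport hx
  · exact fun j _ => (hψU j).integrableOn_inner hU hV

/-! ### Local square integrability -/

/-- `f` is square integrable on the compact subsets of `U`. -/
def MemL2Loc {G : Type*} [NormedAddCommGroup G] (U : Set 𝔼) (f : 𝔼 → G) : Prop :=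
  ∀ K : Set 𝔼, IsCompact K → K ⊆ U → MemLp f 2 (volume.restrict K)

lemma MemL2Loc.locallyIntegrableOn {G : Type*} [NormedAddCommGroup G] {U : Set 𝔼} (hU : IsOpen U)
    {f : 𝔼 → G} (hf : MemL2Loc U f) : LocallyIntegrableOn f U := by
  rw [locallyIntegrableOn_iff hU.isLocallyClosed]
  intro K hKU hK
  have : IsFiniteMeasure (volume.restrict K) := ⟨by simpa using hK.measure_lt_top⟩
  exact (hf K hK hKU).integrable one_le_two

/-- Measurability together with integrability of `‖f‖²` passes to subsets and finite unions, which
is what induction over a compact set requires. -/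
lemma MemL2Loc.of_local {G : Type*} [NormedAddCommGroup G] {U : Set 𝔼} {f : 𝔼 → G}
    (h : ∀ x ∈ U, ∃ N, IsOpen N ∧ x ∈ N ∧ MemL2Loc N f) : MemL2Loc U f := by
  intro K hK hKU
  have key : AEStronglyMeasurable f (volume.restrict K) ∧ IntegrableOn (fun x => ‖f x‖ ^ 2) K := by
    refine hK.induction_on (p := fun s => AEStronglyMeasurable f (volume.restrict s) ∧
      IntegrableOn (fun x => ‖f x‖ ^ 2) s) (by simp)
      (fun s t hst ht => ⟨ht.1.mono_measure (Measure.restrict_mono hst le_rfl),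
        ht.2.mono_set hst⟩)
      (fun s t hs ht => ⟨aestronglyMeasurable_union_iff.2 ⟨hs.1, ht.1⟩, hs.2.union ht.2⟩)
      fun x hx => ?_
    obtain ⟨N, hN, hxN, hf⟩ := h x (hKU hx)
    obtain ⟨K', hK', hxK', hK'N⟩ := exists_compact_subset hN hxN
    have hm := hf K' hK' hK'N
    exact ⟨K', mem_nhdsWithin_of_mem_nhds (mem_interior_iff_mem_nhds.1 hxK'),
      hm.aestronglyMeasurable, (memLp_two_iff_integrable_sq_norm hm.aestronglyMeasurable).1 hm⟩
  exact (memLp_two_iff_integrable_sq_norm key.1).2 key.2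

lemma MemL2Loc.of_bound {U : Set 𝔼} {f g : 𝔼 → ℝ} (hg : MemL2Loc U g)
    (hf : AEStronglyMeasurable f (volume.restrict U)) (h : ∀ x ∈ U, |f x| ≤ g x) :
    MemL2Loc U f := fun K hK hKU =>
  (hg K hK hKU).mono' (hf.mono_measure (Measure.restrict_mono hKU le_rfl))
    (ae_restrict_of_mem hK.measurableSet fun x hx => h x (hKU hx))

lemma Continuous.memL2Loc {G : Type*} [NormedAddCommGroup G] {U : Set 𝔼} {f : 𝔼 → G}
    (hf : Continuous f) : MemL2Loc U f := fun K hK _ => by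
  have : IsFiniteMeasure (volume.restrict K) := ⟨by simpa using hK.measure_lt_top⟩
  obtain ⟨C, hC⟩ := hK.exists_bound_of_continuousOn hf.continuousOn
  exact MemLp.of_bound (hf.continuousOn.aestronglyMeasurable_of_isCompact hK hK.measurableSet) C
    (ae_restrict_of_mem hK.measurableSet hC)

/-! ### Removing the truncation -/

lemma tendsto_heaviside_sub {s : ℝ} (hs : 0 ≤ s) :
    Tendsto (fun j : ℕ => heaviside (s - 1 / ((j : ℝ) + 1))) atTop (𝓝 (heaviside s)) := by
  rcases hs.eq_or_lt with rfl | hs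
  · rw [heaviside_of_nonpos le_rfl]
    refine tendsto_const_nhds.congr fun j => (heaviside_of_nonpos ?_).symm
    rw [zero_sub, neg_nonpos]
    positivity
  · rw [heaviside_of_pos hs]
    refine tendsto_const_nhds.congr' ?_
    filter_upwards [(tendsto_one_div_add_atTop_nhds_zero_nat (𝕜 := ℝ)).eventually_lt_const hs]
      with j hj
    exact (heaviside_of_pos (sub_pos.2 hj)).symm

lemma heaviside_mono {s t : ℝ} (h : s ≤ t) : heaviside s ≤ heaviside t := by
  rcases le_or_gt s 0 with hs | hs
  · rw [heaviside_of_nonpos hs]; exact heaviside_nonneg t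
  · rw [heaviside_of_pos hs, heaviside_of_pos (hs.trans_le h)]

/-- If all truncations `(w - ε)⁺` of a nonnegative `L²_loc` function are subsolutions, then so is
`w`. -/
lemma isWeakSubsolution_of_truncations {U : Set 𝔼} (hU : IsOpen U) {w F : 𝔼 → ℝ} {G : 𝔼 → 𝔼}
    (hw0 : ∀ x ∈ U, 0 ≤ w x) (hw : MemL2Loc U w) (hF : MemL2Loc U F) (hF0 : ∀ x ∈ U, 0 ≤ F x)
    (hgrad : ∀ ε : ℝ, 0 < ε →
      HasWeakGradient U (fun x => max (w x - ε) 0) (fun x => heaviside (w x - ε) • G x))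
    (hsub : ∀ ε : ℝ, 0 < ε → IsSubsolutionGradient U (fun x => heaviside (w x - ε) • G x) F) :
    IsWeakSubsolution U w F := by
  let ε : ℕ → ℝ := fun j => 1 / ((j : ℝ) + 1)
  have hε : ∀ j, 0 < ε j := fun j => by positivity
  have hε0 : Tendsto ε atTop (𝓝 0) := tendsto_one_div_add_atTop_nhds_zero_nat
  have hFi := hF.locallyIntegrableOn hU
  have hwi := hw.locallyIntegrableOn hU
  have hlim : ∀ x ∈ U, Tendsto (fun j => max (w x - ε j) 0) atTop (𝓝 (w x)) := fun x hx => by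
    have : Tendsto (fun j => max (w x - ε j) 0) atTop (𝓝 (max (w x - 0) 0)) :=
      (hε0.const_sub _).max tendsto_const_nhds
    rwa [sub_zero, max_eq_left (hw0 x hx)] at this
  have hlim' : ∀ x ∈ U, Tendsto (fun j => heaviside (w x - ε j) • G x) atTop
      (𝓝 (heaviside (w x) • G x)) := fun x hx =>
    (tendsto_heaviside_sub (hw0 x hx)).smul_const _
  have hvw : ∀ j, ∀ x ∈ U, |max (w x - ε j) 0| ≤ w x := fun j x hx => by
    rw [abs_of_nonneg (le_max_right _ _)]
    exact max_le (by linarith [hε j]) (hw0 x hx)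
  -- The common majorant is `1_{w > 0} ‖G‖` and not `‖G‖`, since nothing is known about `G` off `{w
  -- > 0}`.
  have hGb : ∀ j, ∀ x ∈ U, ‖heaviside (w x - ε j) • G x‖ ≤ ‖heaviside (w x) • G x‖ :=
    fun j x _ => by
      rw [norm_smul, norm_smul, Real.norm_of_nonneg (heaviside_nonneg _),
        Real.norm_of_nonneg (heaviside_nonneg _)]
      exact mul_le_mul_of_nonneg_right (heaviside_mono (by linarith [hε j])) (norm_nonneg _)
  have hGm : AEStronglyMeasurable (fun x => heaviside (w x) • G x) (volume.restrict U) :=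
    aestronglyMeasurable_of_tendsto_ae atTop
      (fun j => (hgrad (ε j) (hε j)).2.1.aestronglyMeasurable)
      (ae_restrict_of_mem hU.measurableSet hlim')
  have hwF : LocallyIntegrableOn (fun x => w x * F x) U := by
    rw [locallyIntegrableOn_iff hU.isLocallyClosed]
    exact fun K hKU hK => (hw K hK hKU).integrable_mul (hF K hK hKU)
  have hw2 : LocallyIntegrableOn (fun x => w x ^ 2) U := by
    rw [locallyIntegrableOn_iff hU.isLocallyClosed]
    exact fun K hKU hK => (hw K hK hKU).integrable_sq
  -- The energy estimate, with a cutoff equal to 1 on `K`, shows that the majorant is square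
  -- integrable on `K`.
  have hG : MemL2Loc U (fun x => heaviside (w x) • G x) := by
    intro K hK hKU
    obtain ⟨φ, hφ, hφ0, hφ1⟩ := exists_testFunction_eq_one hU hK hKU
    have hfin := lintegral_energy_lt_top hU (fun j => hgrad (ε j) (hε j)) hFi
      (fun j => hsub (ε j) (hε j)) hF0 hvw hwF hw2 hlim hlim'
      (fun x _ hx => by rw [heaviside_of_nonpos hx, zero_smul]) hφ hφ0
    have hKs : K ⊆ tsupport φ := fun x hx => by
      by_contra h
      have := hφ1 x hx
      rw [eq_zero_of_notMem_tsupport h] at this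
      exact zero_ne_one this
    have hm := hGm.mono_measure (Measure.restrict_mono hKU le_rfl)
    rw [memLp_two_iff_integrable_sq_norm hm]
    refine ⟨hm.norm.pow 2, ?_⟩
    rw [hasFiniteIntegral_iff_ofReal (.of_forall fun x => sq_nonneg _)]
    refine lt_of_le_of_lt ?_ hfin
    refine le_trans (le_of_eq ?_) (lintegral_mono_set hKs)
    exact setLIntegral_congr_fun hK.measurableSet fun x hx => by rw [hφ1 x hx, one_mul]
  have hGi := (hG.locallyIntegrableOn hU).norm
  refine ⟨fun x => heaviside (w x) • G x, ⟨HasWeakGradient.of_tendsto hU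
    (fun j => hgrad (ε j) (hε j)) hwi hvw hlim hGi hGb hlim', fun K hK hKU =>
      ⟨hw K hK hKU, hG K hK hKU⟩⟩, ?_⟩
  exact IsSubsolutionGradient.of_tendsto hU (fun j => hsub (ε j) (hε j))
    (fun j => (hgrad (ε j) (hε j)).2.1) hGi hGb hlim'

/-! ### Subtracting a harmonic function -/

lemma harmonic_contDiff {h : 𝔼 → ℝ} (hh : InnerProductSpace.HarmonicOnNhd h univ) :
    ContDiff ℝ 1 h :=
  (contDiffOn_univ.1 hh.contDiffOn : ContDiff ℝ 2 h).of_le (by norm_num)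

lemma hasWeakGradient_add_const {U : Set 𝔼} (hU : IsOpen U) {h : 𝔼 → ℝ} (hh : ContDiff ℝ 1 h)
    (c : ℝ) : HasWeakGradient U (fun x => h x + c) (∇ h) := by
  have h1 := hasWeakGradient_of_contDiff hU (hh.add contDiff_const (g := fun _ => c))
  have h2 : ∇ (fun x => h x + c) = ∇ h := by
    funext x
    simp only [gradient, fderiv_add_const]
  rwa [h2] at h1

lemma integral_inner_sub_gradient {U : Set 𝔼} (hU : IsOpen U) {h φ : 𝔼 → ℝ}
    (hh : InnerProductSpace.HarmonicOnNhd h univ) {V : 𝔼 → 𝔼} (hV : LocallyIntegrableOn V U)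
    (hφ : IsTestFunction U φ) :
    ∫ x in U, inner ℝ (V x - ∇ h x) (∇ φ x) = ∫ x in U, inner ℝ (V x) (∇ φ x) := by
  simp only [inner_sub_left]
  rw [integral_sub (hφ.integrableOn_inner hU hV) (hφ.integrableOn_inner hU
    (hasWeakGradient_of_contDiff hU (harmonic_contDiff hh)).2.1),
    integral_inner_gradient_eq_zero hU hh hφ, sub_zero]

lemma IsSubsolutionGradient.sub_harmonic {U : Set 𝔼} (hU : IsOpen U) {h F : 𝔼 → ℝ}
    (hh : InnerProductSpace.HarmonicOnNhd h univ) {V : 𝔼 → 𝔼} (hV : LocallyIntegrableOn V U)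
    (hs : IsSubsolutionGradient U V F) :
    IsSubsolutionGradient U (fun x => V x - ∇ h x) F := fun φ hφ hφ0 => by
  rw [integral_inner_sub_gradient hU hh hV hφ]
  exact hs φ hφ hφ0

lemma IsLocalSolution.sub_harmonic {U : Set 𝔼} (hU : IsOpen U) {h u f : 𝔼 → ℝ}
    (hh : InnerProductSpace.HarmonicOnNhd h univ) (hu : IsLocalSolution U u f) :
    IsLocalSolution U (fun x => u x - h x) f := by
  obtain ⟨V, hV, heq⟩ := hu
  have hc := harmonic_contDiff hh
  refine ⟨fun x => V x - ∇ h x, ⟨hV.1.sub hU (hasWeakGradient_of_contDiff hU hc),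
    fun K hK hKU => ⟨(hV.2 K hK hKU).1.sub (Continuous.memL2Loc hc.continuous K hK hKU),
      (hV.2 K hK hKU).2.sub
        (Continuous.memL2Loc (continuous_gradient_of_contDiff hc) K hK hKU)⟩⟩, fun φ hφ => ?_⟩
  rw [integral_inner_sub_gradient hU hh hV.1.2.1 hφ]
  exact heq φ hφ

/-! ### Local truncations -/

/-- The set where a function is positive is determined by its positive part, so equal positive parts
carry the same indicator in their gradients. -/
lemma heaviside_max (t : ℝ) : heaviside (max t 0) = heaviside t := by
  rcases le_total t 0 with ht | ht
  · rw [max_eq_right ht, heaviside_of_nonpos le_rfl, heaviside_of_nonpos ht]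
  · rw [max_eq_left ht]

/-- On `N`, the truncation `(w - ε)⁺` is a subsolution
with gradient `1_{w > ε} G` and right-hand side `F`, and `w` is locally square integrable. -/
structure TruncationOn (N : Set 𝔼) (w F : 𝔼 → ℝ) (G : 𝔼 → 𝔼) (ε : ℝ) : Prop where
  hasWeakGradient : HasWeakGradient N (fun x => max (w x - ε) 0)
    (fun x => heaviside (w x - ε) • G x)
  isSubsolutionGradient : IsSubsolutionGradient N (fun x => heaviside (w x - ε) • G x) F
  memL2Loc : MemL2Loc N w

/-- If `v` is a subsolution on `N`, `h` is harmonic and `(w - ε)⁺ = (v - h - c)⁺`,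
then `(w - ε)⁺` is a subsolution. -/
lemma truncationOn_of_subsolution {N : Set 𝔼} (hN : IsOpen N) {w F F' v h : 𝔼 → ℝ}
    {V G : 𝔼 → 𝔼} {ε c : ℝ} (hh : InnerProductSpace.HarmonicOnNhd h univ)
    (hv : HasWeakGradient N v V) (hs : IsSubsolutionGradient N V F')
    (hF' : LocallyIntegrableOn F' N) (hFF' : ∀ x ∈ N, max (F' x) 0 = F x)
    (hw : ∀ x ∈ N, max (v x - (h x + c)) 0 = max (w x - ε) 0)
    (hVG : ∀ᵐ x ∂volume.restrict N, 0 < w x - ε → V x - ∇ h x = G x) (hw2 : MemL2Loc N w) :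
    TruncationOn N w F G ε := by
  have hg := hv.sub hN (hasWeakGradient_add_const hN (harmonic_contDiff hh) c)
  have hs' := hs.sub_harmonic hN hh hv.2.1
  have hhv : ∀ x ∈ N, heaviside (v x - (h x + c)) = heaviside (w x - ε) := fun x hx => by
    rw [← heaviside_max, hw x hx, heaviside_max]
  have hae : (fun x => heaviside (v x - (h x + c)) • (V x - ∇ h x))
      =ᵐ[volume.restrict N] fun x => heaviside (w x - ε) • G x := by
    filter_upwards [hVG, ae_restrict_of_mem hN.measurableSet hhv] with x hx hx'
    rw [hx']
    rcases le_or_gt (w x - ε) 0 with h0 | h0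
    · rw [heaviside_of_nonpos h0, zero_smul, zero_smul]
    · rw [hx h0]
  exact ⟨(hg.pos hN).congr (ae_restrict_of_mem hN.measurableSet hw) hae,
    (IsSubsolutionGradient.pos hN hg hF' hs').congr hae
      (ae_restrict_of_mem hN.measurableSet hFF'), hw2⟩

/-- As `ε > 0`, the indicator of `{w > ε}` is zero whatever `G` is, and zero is a subsolution for a
nonnegative right-hand side. -/
lemma truncationOn_of_eq_zero {N : Set 𝔼} (hN : IsOpen N) {w F : 𝔼 → ℝ} {G : 𝔼 → 𝔼} {ε : ℝ}
    (hε : 0 < ε) (hF : ∀ x ∈ N, 0 ≤ F x) (hw : ∀ x ∈ N, w x = 0) : TruncationOn N w F G ε := by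
  have h1 : ∀ x ∈ N, w x - ε ≤ 0 := fun x hx => by rw [hw x hx]; linarith
  have hae : (fun _ => (0 : 𝔼)) =ᵐ[volume.restrict N] fun x => heaviside (w x - ε) • G x :=
    ae_restrict_of_mem hN.measurableSet fun x hx => by
      simp only [heaviside_of_nonpos (h1 x hx), zero_smul]
  refine ⟨hasWeakGradient_zero.congr (ae_restrict_of_mem hN.measurableSet fun x hx =>
      (max_eq_right (h1 x hx)).symm) hae, ?_, ?_⟩
  · refine IsSubsolutionGradient.congr (fun φ _ hφ0 => ?_) hae (.refl _ _)
    simp only [inner_zero_left, integral_zero]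
    exact setIntegral_nonneg hN.measurableSet fun x hx => mul_nonneg (hF x hx) (hφ0 x)
  · intro K hK hKN
    exact (memLp_congr_ae (ae_restrict_of_mem (p := fun x => w x = (0 : 𝔼 → ℝ) x) hK.measurableSet
      fun x hx => hw x (hKN hx))).2 MemLp.zero

lemma isWeakSubsolution_of_truncationOn {U : Set 𝔼} (hU : IsOpen U) {w F : 𝔼 → ℝ} {G : 𝔼 → 𝔼}
    (hw0 : ∀ x ∈ U, 0 ≤ w x) (hF : MemL2Loc U F) (hF0 : ∀ x ∈ U, 0 ≤ F x)
    (h : ∀ ε : ℝ, 0 < ε → ∀ x ∈ U, ∃ N, IsOpen N ∧ x ∈ N ∧ TruncationOn N w F G ε) :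
    IsWeakSubsolution U w F := by
  have hg : ∀ ε : ℝ, 0 < ε →
      HasWeakGradient U (fun x => max (w x - ε) 0) (fun x => heaviside (w x - ε) • G x) :=
    fun ε hε => HasWeakGradient.of_local hU fun x hx => by
      obtain ⟨N, h1, h2, h3⟩ := h ε hε x hx
      exact ⟨N, h1, h2, h3.hasWeakGradient⟩
  refine isWeakSubsolution_of_truncations hU hw0 (MemL2Loc.of_local fun x hx => ?_) hF hF0 hg
    fun ε hε => IsSubsolutionGradient.of_local hU (hg ε hε).2.1 (hF.locallyIntegrableOn hU)
      fun x hx => ?_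
  · obtain ⟨N, h1, h2, h3⟩ := h 1 one_pos x hx
    exact ⟨N, h1, h2, h3.memL2Loc⟩
  · obtain ⟨N, h1, h2, h3⟩ := h ε hε x hx
    exact ⟨N, h1, h2, h3.isSubsolutionGradient⟩

/-! ### The upper boundary condition -/

lemma IsWeakSolution.upper_sub_harmonic {Ω : Set 𝔼} (hΩ : IsOpen Ω)
    (hΩb : Bornology.IsBounded Ω) {u f g h : 𝔼 → ℝ} (hu : IsWeakSolution Ω u f g)
    (hh : InnerProductSpace.HarmonicOnNhd h univ) {r : ℝ} {x₀ : 𝔼} (hr : 0 < r)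
    (hrd : r ≤ diam Ω) :
    IsWeakSubsolution (ball x₀ r)
      (Ω.indicator fun x =>
        max (u x - h x - sSup ((fun x => g x - h x) '' (ball x₀ r ∩ frontier Ω))) 0)
      (Ω.indicator fun x => max (f x) 0) := by
  obtain ⟨U, hU, hUeq⟩ := hu.interior
  have hc := (harmonic_contDiff hh).continuous
  set M := sSup ((fun x => g x - h x) '' (ball x₀ r ∩ frontier Ω))
  set w : 𝔼 → ℝ := Ω.indicator fun x => max (u x - h x - M) 0
  set F : 𝔼 → ℝ := Ω.indicator fun x => max (f x) 0
  have hΩm := hΩ.measurableSet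
  have hwΩ : ∀ x ∈ Ω, w x = max (u x - h x - M) 0 := fun x hx => indicator_of_mem hx _
  have hwΩ' : ∀ x ∉ Ω, w x = 0 := fun x hx => indicator_of_notMem hx _
  have hFΩ : ∀ x ∈ Ω, F x = max (f x) 0 := fun x hx => indicator_of_mem hx _
  have hF0 : ∀ x, 0 ≤ F x := fun x => indicator_nonneg (fun _ _ => le_max_right _ _) x
  have hF2 : MemLp F 2 := by
    refine (memLp_indicator_iff_restrict hΩm).2 ?_
    refine hu.memLp_rhs.mono ((continuous_id.max continuous_const).comp_aestronglyMeasurable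
      hu.memLp_rhs.aestronglyMeasurable) (.of_forall fun x => ?_)
    rw [Real.norm_of_nonneg (le_max_right _ _)]
    exact max_le (le_abs_self _) (abs_nonneg _)
  have hFL : ∀ N, MemL2Loc N F := fun N K _ _ => hF2.restrict K
  have hfi : LocallyIntegrableOn f Ω := by
    have : IsFiniteMeasure (volume.restrict Ω) := ⟨by simpa using hΩb.measure_lt_top⟩
    have hi : IntegrableOn f Ω := hu.memLp_rhs.integrable one_le_two
    exact hi.locallyIntegrableOn
  have hwm : AEStronglyMeasurable w := by
    refine (aestronglyMeasurable_indicator_iff hΩm).2 ?_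
    exact (continuous_id.max continuous_const).comp_aestronglyMeasurable
      ((hU.1.1.aestronglyMeasurable.sub hc.aestronglyMeasurable).sub aestronglyMeasurable_const)
  -- The boundary is compact, so `g - h` is bounded on it; `sSup` is then a true supremum wherever
  -- the set is nonempty, and not the default value 0.
  have hfr : IsCompact (frontier Ω) :=
    isCompact_of_isClosed_isBounded isClosed_frontier (hΩb.closure.subset frontier_subset_closure)
  obtain ⟨Cg, hCg⟩ := hu.locallyBounded_bdry _ hfr subset_rfl
  obtain ⟨Ch, -, hCh⟩ := exists_abs_le_of_continuous hfr hc
  -- One field `U - ∇h` serves for all neighbourhoods; its values outside `Ω` are irrelevant because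
  -- `w = 0` there.
  refine isWeakSubsolution_of_truncationOn (G := fun x => U x - ∇ h x) isOpen_ball
    (fun x _ => indicator_nonneg (fun _ _ => le_max_right _ _) x) (hFL _) (fun x _ => hF0 x)
    fun ε hε y hy => ?_
  by_cases hyΩ : y ∈ Ω
  · have hUs : IsSubsolutionGradient Ω U f := fun φ hφ _ => (hUeq φ hφ).le
    refine ⟨Ω, hΩ, hyΩ, truncationOn_of_subsolution hΩ (c := M + ε) hh hU.1 hUs hfi
      (fun x hx => (hFΩ x hx).symm) (fun x hx => ?_) (.of_forall fun x _ => rfl) ?_⟩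
    · rw [hwΩ x hx]
      rcases max_cases (u x - h x - M) 0 with h1 | h1
      · rw [h1.1]; congr 1; ring
      · rw [h1.1, max_eq_right (by linarith), max_eq_right (by linarith)]
    · have hg : MemL2Loc Ω fun x => |u x| + |h x + M| := fun K hK hKΩ =>
        (hU.2 K hK hKΩ).1.abs.add
          (Continuous.memL2Loc (hc.add continuous_const).abs K hK hKΩ)
      refine hg.of_bound hwm.restrict fun x hx => ?_
      rw [hwΩ x hx, abs_of_nonneg (le_max_right _ _)]
      refine max_le ?_ (by positivity)
      linarith [le_abs_self (u x), neg_abs_le (h x + M)]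
  by_cases hyF : y ∈ frontier Ω
  -- Half of `ε`, because `h` will be compared between two points of the small ball through its
  -- centre `y`.
  · obtain ⟨δ, hδ, hδh⟩ := Metric.continuousAt_iff.1 hc.continuousAt (ε / 2) (half_pos hε)
    obtain ⟨δ', hδ', hδb⟩ := Metric.isOpen_iff.1 isOpen_ball y hy
    -- The radius keeps the oscillation of `h` small, keeps the ball inside `B_r(x₀)`, and is at
    -- most `diam Ω` so that the hypothesis on `u` applies.
    obtain ⟨ρ, hρ, hρδ, hρδ', hρd⟩ : ∃ ρ : ℝ, 0 < ρ ∧ ρ ≤ δ ∧ ρ ≤ δ' ∧ ρ ≤ diam Ω :=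
      ⟨min δ (min δ' (diam Ω)), lt_min hδ (lt_min hδ' (hr.trans_le hrd)), min_le_left _ _,
        (min_le_right _ _).trans (min_le_left _ _), (min_le_right _ _).trans (min_le_right _ _)⟩
    obtain ⟨V, hV, hVs⟩ := hu.upper ρ y hρ hρd hyF
    set k := sSup (g '' (ball y ρ ∩ frontier Ω))
    set N := ball y ρ
    set v : 𝔼 → ℝ := Ω.indicator fun x => max (u x - k) 0
    have hvΩ : ∀ x ∈ Ω, v x = max (u x - k) 0 := fun x hx => indicator_of_mem hx _
    have hvΩ' : ∀ x ∉ Ω, v x = 0 := fun x hx => indicator_of_notMem hx _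
    have hN : IsOpen N := isOpen_ball
    have hosc : ∀ x ∈ N, |h x - h y| < ε / 2 := fun x hx => by
      have := hδh (show dist x y < δ from lt_of_lt_of_le hx hρδ)
      rwa [Real.dist_eq] at this
    have hNr : N ⊆ ball x₀ r := (ball_subset_ball hρδ').trans hδb
    have hbdd : BddAbove ((fun x => g x - h x) '' (ball x₀ r ∩ frontier Ω)) := by
      refine ⟨Cg + Ch, ?_⟩
      rintro _ ⟨x, hx, rfl⟩
      have h1 := abs_le.1 (hCg x hx.2)
      have h2 := abs_le.1 (hCh x hx.2)
      simp only
      linarith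
    -- For a boundary point `p` of the small ball, `g p ≤ M + h p ≤ M + h x + ε`; the supremum over
    -- `p` gives `k ≤ h x + M + ε`.
    have hkM : ∀ x ∈ N, 0 ≤ h x + (M + ε - k) := fun x hx => by
      have : k ≤ h x + M + ε := by
        refine csSup_le ⟨g y, y, ⟨mem_ball_self hρ, hyF⟩, rfl⟩ ?_
        rintro _ ⟨p, hp, rfl⟩
        have h1 : g p - h p ≤ M := le_csSup hbdd ⟨p, ⟨hNr hp.1, hp.2⟩, rfl⟩
        have h2 := abs_lt.1 (hosc p hp.1)
        have h3 := abs_lt.1 (hosc x hx)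
        linarith
      linarith
    -- For `ℓ ≥ 0` one has `((u - k)⁺ - ℓ)⁺ = (u - k - ℓ)⁺`, so cutting at `k` first loses nothing.
    -- Off `Ω` both sides vanish, again because `ℓ = h + M + ε - k ≥ 0`.
    have hweq : ∀ x ∈ N, max (v x - (h x + (M + ε - k))) 0 = max (w x - ε) 0 := fun x hx => by
      have h0 := hkM x hx
      by_cases hxΩ : x ∈ Ω
      · rw [hwΩ x hxΩ, hvΩ x hxΩ]
        rcases max_cases (u x - k) 0 with h1 | h1 <;>
        rcases max_cases (u x - h x - M) 0 with h2 | h2 <;> rw [h1.1, h2.1]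
        · congr 1; ring
        · rw [max_eq_right (by linarith), max_eq_right (by linarith)]
        · rw [max_eq_right (by linarith), max_eq_right (by linarith)]
        · rw [max_eq_right (by linarith), max_eq_right (by linarith)]
      · rw [hwΩ' x hxΩ, hvΩ' x hxΩ, max_eq_right (by linarith), max_eq_right (by linarith)]
    have hNΩ : IsOpen (N ∩ Ω) := hN.inter hΩ
    -- The boundary condition supplies some weak gradient `V` of `(u - k)⁺`; uniqueness on `N ∩ Ω`
    -- ties it to `U`.
    have hVU : ∀ᵐ x, x ∈ N ∩ Ω → V x = heaviside (u x - k) • U x := by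
      rw [← ae_restrict_iff' hNΩ.measurableSet]
      have h1 : HasWeakGradient (N ∩ Ω) (fun x => max (u x - k) 0) V :=
        (hV.1.mono hNΩ hN inter_subset_left).congr
          (ae_restrict_of_mem hNΩ.measurableSet fun x hx => hvΩ x hx.2) (.refl _ _)
      have h2 : HasWeakGradient (N ∩ Ω) (fun x => u x - k) U := by
        have h3 := (hU.1.mono hNΩ hΩ inter_subset_right).sub hNΩ
          (hasWeakGradient_of_contDiff hNΩ (contDiff_const (c := k)))
        simpa only [gradient_fun_const', sub_zero] using h3
      exact h1.ae_eq hNΩ (h2.pos hNΩ)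
    have hFN : ∀ x ∈ N, max (F x) 0 = F x := fun x _ => max_eq_left (hF0 x)
    refine ⟨N, hN, mem_ball_self hρ, truncationOn_of_subsolution hN (c := M + ε - k) hh hV.1 hVs
      ((hFL N).locallyIntegrableOn hN) hFN hweq ?_ ?_⟩
    -- The inequality `w > ε` forces `x ∈ Ω` and `u > k`, where the indicator equals 1 and `V = U`.
    · rw [ae_restrict_iff' hN.measurableSet]
      filter_upwards [hVU] with x hx hxN hwx
      have hxΩ : x ∈ Ω := by
        by_contra hxΩ
        rw [hwΩ' x hxΩ] at hwx
        linarith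
      have hvx : 0 < v x - (h x + (M + ε - k)) := by
        by_contra hle
        have := hweq x hxN
        rw [max_eq_right (not_lt.1 hle), max_eq_left hwx.le] at this
        linarith
      have hux : 0 < u x - k := by
        by_contra hle
        rw [hvΩ x hxΩ, max_eq_right (not_lt.1 hle)] at hvx
        linarith [hkM x hxN]
      rw [hx ⟨hxN, hxΩ⟩, heaviside_of_pos hux, one_smul]
    · have hg : MemL2Loc N fun x => |v x| + |h x + (M - k)| := fun K hK hKΩ =>
        (hV.2 K hK hKΩ).1.abs.add
          (Continuous.memL2Loc (hc.add continuous_const).abs K hK hKΩ)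
      refine hg.of_bound hwm.restrict fun x hx => ?_
      by_cases hxΩ : x ∈ Ω
      · rw [hwΩ x hxΩ, hvΩ x hxΩ, abs_of_nonneg (le_max_right _ _)]
        refine max_le ?_ (by positivity)
        linarith [le_abs_self (max (u x - k) 0), le_max_left (u x - k) 0,
          neg_abs_le (h x + (M - k))]
      · rw [hwΩ' x hxΩ, abs_zero]
        positivity
  · have hyc : y ∈ (closure Ω)ᶜ := fun hyc => hyF ⟨hyc, fun hi => hyΩ (interior_subset hi)⟩
    exact ⟨_, isClosed_closure.isOpen_compl, hyc, truncationOn_of_eq_zero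
      isClosed_closure.isOpen_compl hε (fun x _ => hF0 x)
      fun x hx => hwΩ' x fun hxΩ => hx (subset_closure hxΩ)⟩

/-! ### Reflection `u ↦ -u` -/

/-- On `ℝ`, `sInf` is defined as minus the `sSup` of the negated set, so no boundedness or
nonemptiness is needed. -/
lemma sSup_image_neg (g : 𝔼 → ℝ) (s : Set 𝔼) :
    sSup ((fun x => -g x) '' s) = - sInf (g '' s) := by
  rw [Real.sInf_def, neg_neg]
  congr 1
  ext t
  simp [neg_eq_iff_eq_neg]

lemma sInf_image_neg (g : 𝔼 → ℝ) (s : Set 𝔼) :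
    sInf ((fun x => -g x) '' s) = - sSup (g '' s) := by
  have := sSup_image_neg (fun x => -g x) s
  simp only [neg_neg] at this
  linarith

lemma IsLocalSolution.neg {U : Set 𝔼} {u f : 𝔼 → ℝ} (hu : IsLocalSolution U u f) :
    IsLocalSolution U (fun x => -u x) (fun x => -f x) := by
  obtain ⟨V, ⟨⟨h1, h2, h3⟩, h4⟩, h5⟩ := hu
  refine ⟨fun x => -V x, ⟨⟨h1.neg, h2.neg, fun φ hφ i => ?_⟩,
    fun K hK hKU => ⟨(h4 K hK hKU).1.neg, (h4 K hK hKU).2.neg⟩⟩, fun φ hφ => ?_⟩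
  · simp only [neg_mul, PiLp.neg_apply, mul_neg, integral_neg, h3 φ hφ i]
  · simp only [inner_neg_left, neg_mul, integral_neg, h5 φ hφ]

/-- Negation exchanges the two boundary conditions, so the lower one follows from the upper one. -/
lemma IsWeakSolution.neg {Ω : Set 𝔼} {u f g : 𝔼 → ℝ} (hu : IsWeakSolution Ω u f g) :
    IsWeakSolution Ω (fun x => -u x) (fun x => -f x) (fun x => -g x) where
  memLp_rhs := hu.memLp_rhs.neg
  locallyBounded_bdry K hK hKΩ := by simpa only [abs_neg] using hu.locallyBounded_bdry K hK hKΩ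
  interior := hu.interior.neg
  upper r x₀ hr hrd hx₀ := by
    have := hu.lower r x₀ hr hrd hx₀
    rw [sSup_image_neg]
    simpa only [neg_sub, sub_neg_eq_add, neg_add_eq_sub] using this
  lower r x₀ hr hrd hx₀ := by
    have := hu.upper r x₀ hr hrd hx₀
    rw [sInf_image_neg]
    simpa only [neg_sub, sub_neg_eq_add, neg_neg, neg_add_eq_sub] using this

end HarmonicTranslation

end DirichletWeak

/-! ### The lemma -/

theorem lemma3p2 {n : ℕ} (Ω : Set (EuclideanSpace ℝ (Fin n)))
    (hΩ_open : IsOpen Ω) (hΩ_conn : IsConnected Ω) (hΩ_bdd : Bornology.IsBounded Ω)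
    (u f g h : EuclideanSpace ℝ (Fin n) → ℝ)
    (hu : DirichletWeak.IsWeakSolution Ω u f g)
    (hh : InnerProductSpace.HarmonicOnNhd h Set.univ) :
    DirichletWeak.IsWeakSolution Ω (fun x => u x - h x) f (fun x => g x - h x) where
  memLp_rhs := hu.memLp_rhs
  locallyBounded_bdry K hK hKΩ := by
    obtain ⟨C, hC⟩ := hu.locallyBounded_bdry K hK hKΩ
    obtain ⟨C', -, hC'⟩ := DirichletWeak.exists_abs_le_of_continuous hK
      (DirichletWeak.harmonic_contDiff hh).continuous
    exact ⟨C + C', fun x hx => (abs_sub _ _).trans (add_le_add (hC x hx) (hC' x hx))⟩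
  interior := hu.interior.sub_harmonic hΩ_open hh
  upper r x₀ hr hrd _ := hu.upper_sub_harmonic hΩ_open hΩ_bdd hh hr hrd
  lower r x₀ hr hrd _ := by
    -- The upper condition for `-u`, `-f`, `-g` and the harmonic function `-h`; what follows only
    -- matches signs.
    have h1 := hu.neg.upper_sub_harmonic hΩ_open hΩ_bdd hh.neg (x₀ := x₀) hr hrd
    have h2 : (fun x => -g x - (-h) x) = fun x => -(g x - h x) := by
      funext x
      simp only [Pi.neg_apply]
      ring
    rw [h2, DirichletWeak.sSup_image_neg] at h1
    convert h1 using 3 with x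
    simp only [Pi.neg_apply]
    congr 1
    ring
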